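/- Let $n\ge r\ge 1$ be integers such that $n=q_1r+r_1$ with $0<r_1<r$ and $r=q_2r_1+r_2$ with $0\le r_2<r_1$ (the first two steps of the Euclidean algorithm). **Jacobian extensions.** Let $\mathcal A$ be the ring of germs at $0$ of holomorphic functions on $\mathbb C^m$ with coordinates $x_1,\dots,x_m$. For an ideal $J\subseteq\mathcal A$, let $\Delta_kJ$ be the ideal generated by $J$ and all $k\times k$ minors of the Jacobian matrix $(\partial f/\partial x_j)_{f\in J,\,1\le j\le m}$ (so $\Delta_0J=\mathcal A$ and $\Delta_{m+1}J=J$), and put $\Delta^iJ=\Delta_{m-i+1}J$. The critical extension of a proper ideal $J$ is $\Delta^iJ=\Delta_kJ$, where $k=m-i+1$ is the least order with $\Delta_kJ\ne\mathcal A$. The Thom–Boardman symbol $TB(J)=(i_1,i_2,\dots)$ is the sequence of upper indices of the successive critical extensions $J\subseteq\Delta^{i_1}J\subseteq\Delta^{i_2}\Delta^{i_1}J\subseteq\cdots$; it is regarded as an infinite sequence, whose entries are $0$ once the maximal ideal is reached. **The multiplication map.** Let $f(x)=x^n+a_{n-1}x^{n-1}+\dots+a_0$, $g(x)=x^r+b_{r-1}x^{r-1}+\dots+b_0$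 and $f(x)g(x)=x^{n+r}+c_{n+r-1}x^{n+r-1}+\dots+c_0$. Let $I(\mu_{n,r})=(c_0,\dots,c_{n+r-1})$ in the ring of holomorphic germs at the origin of $\mathbb C^n\times\mathbb C^r$ with coordinates $a_0,\dots,a_{n-1},b_0,\dots,b_{r-1}$ (so $m=n+r$). **The polynomials.** Put $A(t)=1+a_{n-1}t+\dots+a_0t^n$ and $B(t)=1+b_{r-1}t+\dots+b_0t^r$, and define polynomials $d_i,\gamma_i,\beta_i$ in the $a$'s and $b$'s by the power series expansions $$D(t)=B(t)^{-1}A(t)=1+\sum_{j\ge1}d_{n-j}t^j,\qquad B(t)^{-q_1}A(t)=1+\sum_{j\ge1}\gamma_{n-j}t^j,\qquad \bigl(B(t)^{-q_1}D(t)\bigr)^{-1}=1+\sum_{j\ge1}\beta_{n-j}t^j .$$ Let - $\psi_i=d_i$ for $0\le i<r$; - $\psi_{sr+i}=\dfrac{\partial^{s-1}}{\partial b_0^{s-1}}\dfrac{\partial d_{r-1}}{\partial b_{r-1-i}}$ for $1\le s\le q_1-1$ and $0\le i<r$; - $\psi_{q_1r+i}=\beta_{(q_1-1)r+r_1+i}$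 for $0\le i<r_1$. These are the polynomials $\psi_0,\dots,\psi_{n-1}$ attached to the pair $(n,r)$. The same construction (with quotient $q_2$ and remainder $r_2$, the last family being empty if $r_2=0$) attaches to the pair $(r,r_1)$ polynomials in the coefficients of two generic monic polynomials of degrees $r$ and $r_1$. Let $\varphi_0,\dots,\varphi_{r-1}$ be obtained from these by substituting the coefficients of $g(x)$ for those of the polynomial of degree $r$, and the coefficients of $x^{r_1}+\gamma_{n-1}x^{r_1-1}+\dots+\gamma_{n-r_1}$ for those of the polynomial of degree $r_1$. **Theorem.** For every $s=1,\dots,q_2$, $$(\Delta^{r_1})^s(\Delta^r)^{q_1}I(\mu_{n,r})=I(\mu_{n,r})+(\psi_0,\dots,\psi_{q_1r-1},\varphi_0,\dots,\varphi_{sr_1-1}),$$ and $$\Delta^{r_2}(\Delta^{r_1})^{q_2}(\Delta^r)^{q_1}I(\mu_{n,r})=I(\mu_{n,r})+(\psi_0,\dots,\psi_{q_1r-1},\varphi_0,\dots,\varphi_{q_2r_1-1},\varphi_{q_2r_1},\dots,\varphi_{q_2r_1+r_2-1}).$$ Moreover, the first $q_1+q_2+1$ entries of $TB(I(\mu_{n,r}))$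 are $(r,\dots,r,r_1,\dots,r_1,r_2)$, with $r$ repeated $q_1$ times and $r_1$ repeated $q_2$ times. -/

import Mathlib

open scoped Topology

namespace ThomBoardman

/-! ### Germs of holomorphic functions at the origin of `ℂ^σ` -/

section Germs

variable (σ : Type) [Fintype σ]

/-- The ring of germs at the origin of holomorphic functions on `ℂ^σ`. -/
def analyticGerms : Subring (Filter.Germ (𝓝 (0 : σ → ℂ)) ℂ) where
  carrier := {g | ∃ f : (σ → ℂ) → ℂ, AnalyticAt ℂ f 0 ∧ (f : Filter.Germ (𝓝 (0 : σ → ℂ)) ℂ) = g}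
  mul_mem' := by
    rintro _ _ ⟨f, hf, rfl⟩ ⟨g, hg, rfl⟩
    exact ⟨f * g, hf.mul hg, rfl⟩
  one_mem' := ⟨1, analyticAt_const, rfl⟩
  add_mem' := by
    rintro _ _ ⟨f, hf, rfl⟩ ⟨g, hg, rfl⟩
    exact ⟨f + g, hf.add hg, rfl⟩
  zero_mem' := ⟨0, analyticAt_const, rfl⟩
  neg_mem' := by
    rintro _ ⟨f, hf, rfl⟩
    exact ⟨-f, hf.neg, rfl⟩

variable {σ}

/-- The partial derivative `∂g/∂x_i` of a holomorphic germ. -/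
noncomputable def partialDeriv [DecidableEq σ] (i : σ) (g : analyticGerms σ) : analyticGerms σ :=
  ⟨Filter.Germ.map' (fun f x => fderiv ℂ f x (Pi.single i 1))
      (fun _ _ h => h.fderiv.fun_comp (fun L : (σ → ℂ) →L[ℂ] ℂ => L (Pi.single i 1))) g.1, by
    obtain ⟨_, f, hf, rfl⟩ := g
    exact ⟨fun x => fderiv ℂ f x (Pi.single i 1),
      ((ContinuousLinearMap.apply ℂ ℂ (Pi.single i (1 : ℂ) : σ → ℂ)).analyticAt _).comp
        (AnalyticAt.fderiv hf), rfl⟩⟩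

/-- The germ at the origin of a polynomial function. -/
noncomputable def polyGerm (p : MvPolynomial σ ℂ) : analyticGerms σ :=
  ⟨((fun x : σ → ℂ => MvPolynomial.eval x p) : Filter.Germ (𝓝 (0 : σ → ℂ)) ℂ), _,
    AnalyticOnNhd.eval_mvPolynomial p 0 (Set.mem_univ _), rfl⟩

/-! ### Jacobian extensions and the Thom-Boardman symbol -/

variable [DecidableEq σ]

/-- The Jacobian extension `Δ_k J`: the ideal spanned by `J` and all minors of order `k` of the
Jacobian matrix `(∂f/∂x_j)`, `f ∈ J`. (Repeated rows or columns only contribute the minor `0`; for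
`k = 0` the minor is `1`.) -/
noncomputable def jacobianExtension (k : ℕ) (J : Ideal (analyticGerms σ)) :
    Ideal (analyticGerms σ) :=
  J ⊔ Ideal.span {δ | ∃ (f : Fin k → J) (x : Fin k → σ),
    δ = (Matrix.of fun i j => partialDeriv (x j) (f i : analyticGerms σ)).det}

/-- Upper indexing: `Δ^i J = Δ_{m - i + 1} J`, with `m` the number of variables. -/
noncomputable def upperExtension (i : ℕ) (J : Ideal (analyticGerms σ)) :
    Ideal (analyticGerms σ) :=
  jacobianExtension (Fintype.card σ + 1 - i) J

/-- The upper index of the critical extension of `J`: it is `m + 1 - k`, where `k` is the least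
order for which `Δ_k J` is not the whole ring. -/
noncomputable def criticalIndex (J : Ideal (analyticGerms σ)) : ℕ :=
  Fintype.card σ + 1 - sInf {k : ℕ | jacobianExtension k J ≠ ⊤}

/-- The successive critical extensions of `J`, starting with `J` itself. -/
noncomputable def criticalChain (J : Ideal (analyticGerms σ)) : ℕ → Ideal (analyticGerms σ)
  | 0 => J
  | k + 1 => upperExtension (criticalIndex (criticalChain J k)) (criticalChain J k)

/-- The Thom-Boardman symbol of `J` as an infinite sequence: entry number `k` (counted from `0`)
is the upper index of the critical extension leading from the `k`-th ideal of the chain of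
critical extensions to the next one. -/
noncomputable def tbSymbol (J : Ideal (analyticGerms σ)) (k : ℕ) : ℕ :=
  criticalIndex (criticalChain J k)

end Germs

/-! ### The multiplication map -/

section Multiplication

/-- Polynomials in the coefficients `a_0, …, a_{n-1}` of `f` (left summand) and
`b_0, …, b_{r-1}` of `g` (right summand). -/
abbrev CoeffPoly (n r : ℕ) : Type := MvPolynomial (Fin n ⊕ Fin r) ℂ

/-- The generic monic polynomial `f(x) = x^n + a_{n-1} x^{n-1} + ⋯ + a_0`. -/
noncomputable def genericF (n r : ℕ) : Polynomial (CoeffPoly n r) :=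
  Polynomial.X ^ n +
    ∑ i : Fin n, Polynomial.C (MvPolynomial.X (Sum.inl i)) * Polynomial.X ^ (i : ℕ)

/-- The generic monic polynomial `g(x) = x^r + b_{r-1} x^{r-1} + ⋯ + b_0`. -/
noncomputable def genericG (n r : ℕ) : Polynomial (CoeffPoly n r) :=
  Polynomial.X ^ r +
    ∑ j : Fin r, Polynomial.C (MvPolynomial.X (Sum.inr j)) * Polynomial.X ^ (j : ℕ)

/-- The ideal `I(μ_{n,r})` generated by the germs of the coefficients `c_0, …, c_{n+r-1}` of
`f(x) g(x)`. -/
noncomputable def multIdeal (n r : ℕ) : Ideal (analyticGerms (Fin n ⊕ Fin r)) :=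
  Ideal.span {h | ∃ j < n + r, h = polyGerm ((genericF n r * genericG n r).coeff j)}

/-! The lower Toeplitz matrix with coefficients `v_0 = 1, v_1, v_2, …` along its diagonals is
`∑ v_j L^j` for the nilpotent lower shift `L`, and sums, products and inverses of such matrices are
those of the power series `∑ v_j t^j`, truncated. The polynomials below are read off as coefficients
of these power series. -/

/-- `A(t) = 1 + a_{n-1} t + ⋯ + a_0 t^n`. -/
noncomputable def seriesA (n r : ℕ) : PowerSeries (CoeffPoly n r) :=
  1 + ∑ i : Fin n, PowerSeries.C (MvPolynomial.X (Sum.inl i)) * PowerSeries.X ^ (n - (i : ℕ))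

/-- `B(t) = 1 + b_{r-1} t + ⋯ + b_0 t^r`. -/
noncomputable def seriesB (n r : ℕ) : PowerSeries (CoeffPoly n r) :=
  1 + ∑ j : Fin r, PowerSeries.C (MvPolynomial.X (Sum.inr j)) * PowerSeries.X ^ (r - (j : ℕ))

/-- `B(t)⁻¹`. -/
noncomputable def invB (n r : ℕ) : PowerSeries (CoeffPoly n r) :=
  PowerSeries.invOfUnit (seriesB n r) 1

/-- `D(t) = B(t)⁻¹ A(t) = 1 + d_{n-1} t + ⋯ + d_0 t^n + ⋯`. -/
noncomputable def seriesD (n r : ℕ) : PowerSeries (CoeffPoly n r) :=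
  invB n r * seriesA n r

/-- The polynomial `d_i`, for `i ≤ n`. -/
noncomputable def dPoly (n r i : ℕ) : CoeffPoly n r :=
  PowerSeries.coeff (n - i) (seriesD n r)

/-- The polynomial `γ_i`, for `i ≤ n`: `B(t)^{-q} A(t) = 1 + γ_{n-1} t + γ_{n-2} t^2 + ⋯`, where `q`
is the quotient of `n` by `r`. -/
noncomputable def gammaPoly (n r i : ℕ) : CoeffPoly n r :=
  PowerSeries.coeff (n - i) (invB n r ^ (n / r) * seriesA n r)

/-- The polynomial `β_i`, for `i ≤ n`: `(B(t)^{-q} D(t))⁻¹ = 1 + β_{n-1} t + β_{n-2} t^2 + ⋯`,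
where `q` is the quotient of `n` by `r`. -/
noncomputable def betaPoly (n r i : ℕ) : CoeffPoly n r :=
  PowerSeries.coeff (n - i) (PowerSeries.invOfUnit (invB n r ^ (n / r) * seriesD n r) 1)

/-- The polynomials `ψ_{sr+i}` with `0 ≤ i < r`: `d_i` for `s = 0`, and
`(∂/∂b_0)^{s-1} (∂ d_{r-1} / ∂b_{r-1-i})` for `s ≥ 1`. -/
noncomputable def psiBlock (n r : ℕ) : ℕ → Fin r → CoeffPoly n r
  | 0, i => dPoly n r i
  | s + 1, i =>
      (fun p => MvPolynomial.pderiv (Sum.inr ⟨0, i.pos⟩) p)^[s]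
        (MvPolynomial.pderiv (Sum.inr i.rev) (dPoly n r (r - 1)))

/-- The polynomials `ψ_0, …, ψ_{n-1}` attached to `μ_{n,r}`, where `n = q r + ρ` is the division
with remainder of `n` by `r`: `ψ_k` for `k < q r` is given by `psiBlock`, and
`ψ_{qr+i} = β_{(q-1)r+ρ+i}` for `0 ≤ i < ρ`. -/
noncomputable def psi (n r k : ℕ) : CoeffPoly n r :=
  if hr : 0 < r then
    if k < n / r * r then psiBlock n r (k / r) ⟨k % r, Nat.mod_lt k hr⟩
    else betaPoly n r ((n / r - 1) * r + n % r + (k - n / r * r))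
  else 0

/-- The polynomials `φ_0, …, φ_{r-1}`: with `ρ` the remainder of `n` by `r`, they are the
polynomials `ψ_k` attached to `μ_{r,ρ}`, evaluated at the coefficients `b_0, …, b_{r-1}` of
`f_1(x) = g(x)` and the coefficients `γ_{n-ρ}, …, γ_{n-1}` of
`f_2(x) = x^ρ + γ_{n-1} x^{ρ-1} + ⋯ + γ_{n-ρ}`. -/
noncomputable def phi (n r k : ℕ) : CoeffPoly n r :=
  MvPolynomial.aeval
    (Sum.elim (fun j : Fin r => (MvPolynomial.X (Sum.inr j) : CoeffPoly n r))
      (fun j : Fin (n % r) => gammaPoly n r (n - n % r + (j : ℕ))))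
    (psi r (n % r) k)

/-- The ideal `I(μ_{n,r}) + (ψ_0, …, ψ_{u-1}, φ_0, …, φ_{v-1})`. -/
noncomputable def extendedIdeal (n r u v : ℕ) : Ideal (analyticGerms (Fin n ⊕ Fin r)) :=
  multIdeal n r ⊔
    Ideal.span ({h | ∃ k < u, h = polyGerm (psi n r k)} ∪ {h | ∃ k < v, h = polyGerm (phi n r k)})

end Multiplication

end ThomBoardman

namespace ThomBoardman

/-! ### Two determinantal facts -/

section Minors

variable {R : Type*} [CommRing R]

/-! Reversing polynomials turns the coefficients of `f g` into those of `A(t) B(t)`, so modulo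
`I(μ_{n,r})` the polynomials `A` and `B` satisfy `A B = 1`. More generally, a `Chart` is an ideal
`J` cutting out the pairs of polynomials `U`, `V` of degrees at most `u`, `v`, with constant
coefficient `1` and `U ^ α * V ^ β = 1`, where `α, β > 0`.

Suppose `v ≤ u`. A tangent vector of this scheme is a pair `(U', V')` within the same degree bounds,
without constant coefficient, with `α V U' + β U V' = 0`, that is, `U' = -(β/α) (U/V) V'`. If the
series `U/V` has degree at most `u - v`, every `V'` is allowed; this gives `v` independent tangent
vectors, and the Jacobian minors of order `m - v + 1` vanish (`m` variables). Conversely, where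
these minors vanish there is a tangent vector with `V' = t ^ v`, and `deg U' ≤ u` forces `deg (U/V)
≤ u - v`. At the closed point `U = V = 1`, and some minor of order `m - v` is a unit. Hence the
critical index is `v`, and the critical extension adjoins the coefficients of `U/V` of orders `u - v
+ 1, …, u` (`Chart.jacExt_eq`).

The new ideal again has a chart, namely `(U/V, V)` with degrees `u - v`, `v` and relation `(U/V) ^ α
* V ^ (α + β) = 1` (`Chart.quotient`). So critical extensions perform the subtractive Euclidean
algorithm on degrees, with the roles of `U` and `V` exchanged when needed: index `r` occurs `q₁`
times, then `r₁` occurs `q₂` times, then `r₂`.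

It remains to recognise the generators. Since `∂B/∂b_j = t ^ (r - j)`, differentiating `B⁻¹ A`
repeatedly produces the coefficients of the `B ^ (-s) A` up to nonzero constants
(`exists_psiBlock_eq`). The `φ` follow by substituting the pair `B`, `P = B ^ (-q₁) A`, which is
legitimate because `P` is a polynomial of degree `r₁` modulo the ideal already reached
(`map_phiReduction_seriesB`). -/

/-- A product of matrices that factors through fewer indices than its size has determinant `0`. -/
theorem det_mul_eq_zero_of_card_lt {ρ σ : Type*} [Fintype ρ] [DecidableEq ρ] [Fintype σ]
    [DecidableEq σ] (h : Fintype.card ρ = Fintype.card σ + 1) (P : Matrix ρ σ R)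
    (Q : Matrix σ ρ R) : (P * Q).det = 0 := by
  have e : ρ ≃ Option σ := Fintype.equivOfCardEq (by rw [h, Fintype.card_option])
  -- Padding `P` by a zero column and `Q` by a zero row makes both factors square.
  have hPQ : P * Q = (Matrix.of fun i (j : ρ) => ((e j).elim 0 (P i) : R)) *
      (Matrix.of fun (i : ρ) j => ((e i).elim 0 (fun s => Q s j) : R)) := by
    ext i j
    rw [Matrix.mul_apply, Matrix.mul_apply,
      ← e.symm.sum_comp, Fintype.sum_option]
    simp
  rw [hPQ, Matrix.det_mul, Matrix.det_eq_zero_of_column_eq_zero (e.symm none) (by simp), zero_mul]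

/-- If the rows of `F` are killed by `v` columns which are independent in the sense that they have
a left inverse up to a unit, the minors of `F` of order larger than the codimension vanish. -/
theorem det_submatrix_eq_zero_of_mul_eq_zero {κ ν σ : Type*} [Fintype κ] [DecidableEq κ]
    [Fintype ν] [DecidableEq ν] [Fintype σ] [DecidableEq σ]
    (h : Fintype.card κ + Fintype.card ν = Fintype.card σ + 1) (F : Matrix κ σ R)
    (W : Matrix σ ν R) (Y : Matrix ν σ R) (hF : F * W = 0) (hY : Y * W = 1) (c : κ → σ) :
    (F.submatrix id c).det = 0 := by
  have hc : F * (Matrix.of fun (s : σ) (j : κ) => if c j = s then (1 : R) else 0) =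
      F.submatrix id c := by
    ext i j
    simp [Matrix.mul_apply]
  -- Stacking `F` over `Y` and multiplying by the columns selected by `c` followed by `W` gives a
  -- block triangular matrix whose diagonal blocks are the minor and `1`.
  have key := det_mul_eq_zero_of_card_lt (ρ := κ ⊕ ν) (σ := σ) (by simpa using h)
    (Matrix.fromRows F Y)
    (Matrix.fromCols (Matrix.of fun (s : σ) (j : κ) => if c j = s then (1 : R) else 0)
      (W : Matrix σ ν R))
  rwa [Matrix.fromRows_mul_fromCols, hc, hF, hY, Matrix.det_fromBlocks_zero₁₂, Matrix.det_one,
    mul_one] at key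

/-- If an order `ι` minor of `F` is invertible and all minors of `F` bordered by the row `f` vanish,
then `f` is a combination of the rows of `F`. -/
theorem exists_vecMul_eq_of_bordered_minors {ι σ : Type*} [Fintype ι] [DecidableEq ι]
    (F : Matrix ι σ R) (c : ι → σ) (hc : IsUnit (F.submatrix id c).det) (f : σ → R)
    (hf : ∀ s : σ, ((Matrix.of (Sum.elim F fun _ : Unit => f)).submatrix id
      (Sum.elim c fun _ => s)).det = 0) :
    ∃ l : ι → R, Matrix.vecMul l F = f := by
  let _ := Matrix.invertibleOfIsUnitDet _ hc
  refine ⟨Matrix.vecMul (fun j => f (c j)) (⅟(F.submatrix id c)), ?_⟩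
  ext s
  have h := hf s
  have hb : (Matrix.of (Sum.elim F fun _ : Unit => f)).submatrix id (Sum.elim c fun _ => s) =
      Matrix.fromBlocks (F.submatrix id c) (Matrix.of fun i (_ : Unit) => F i s)
        (Matrix.of fun (_ : Unit) j => f (c j)) (Matrix.of fun _ _ => f s) := by
    ext i j
    rcases i with i | i <;> rcases j with j | j <;> rfl
  -- The bordered minor is the unit minor times its `1 × 1` Schur complement, whose vanishing is the
  -- claim in column `s`.
  rw [hb, Matrix.det_fromBlocks₁₁, hc.mul_right_eq_zero, Matrix.det_unique] at h
  rw [Matrix.sub_apply, sub_eq_zero] at h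
  exact h.symm

/-- Independent rows of a matrix over a field admit an invertible minor of full order. -/
theorem exists_isUnit_det_submatrix {K ι σ : Type*} [Field K] [Fintype ι] [DecidableEq ι]
    [Fintype σ] (F : Matrix ι σ K) (hF : LinearIndependent K F.row) :
    ∃ c : ι → σ, IsUnit (F.submatrix id c).det := by
  classical
  obtain ⟨κ, a, ha, hspan, hli⟩ := exists_linearIndependent' K F.col
  have : Finite κ := Finite.of_injective a ha
  have := Fintype.ofFinite κ
  have hrank : F.rank = Fintype.card ι := hF.rank_matrix
  have hcard : Fintype.card κ = Fintype.card ι := by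
    rw [← hrank, Matrix.rank_eq_finrank_span_cols, ← hspan, finrank_span_eq_card hli]
  let e : ι ≃ κ := Fintype.equivOfCardEq hcard.symm
  refine ⟨a ∘ e, ?_⟩
  rw [← Matrix.isUnit_iff_isUnit_det, ← Matrix.linearIndependent_cols_iff_isUnit]
  exact hli.comp e e.injective

end Minors

/-! ### Power series of bounded degree and derivations of their coefficients -/

section Series

open PowerSeries

variable {A S : Type*} [CommRing A] [CommRing S]

/-- The power series `W` is a polynomial of degree at most `d`. -/
def DegLE (W : S⟦X⟧) (d : ℕ) : Prop :=
  ∀ j, d < j → coeff j W = 0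

theorem DegLE.mul {W Z : S⟦X⟧} {c d : ℕ} (hW : DegLE W c) (hZ : DegLE Z d) :
    DegLE (W * Z) (c + d) := by
  intro j hj
  rw [coeff_mul]
  refine Finset.sum_eq_zero fun p hp => ?_
  rw [Finset.HasAntidiagonal.mem_antidiagonal] at hp
  rcases lt_or_ge c p.1 with h | h
  · rw [hW _ h, zero_mul]
  · rw [hZ _ (by omega), mul_zero]

theorem DegLE.add {W Z : S⟦X⟧} {d : ℕ} (hW : DegLE W d) (hZ : DegLE Z d) : DegLE (W + Z) d := by
  intro j hj
  rw [map_add, hW j hj, hZ j hj, add_zero]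

theorem DegLE.C_mul {W : S⟦X⟧} {d : ℕ} (hW : DegLE W d) (a : S) : DegLE (C a * W) d := by
  intro j hj
  rw [coeff_C_mul, hW j hj, mul_zero]

theorem DegLE.mono {W : S⟦X⟧} {c d : ℕ} (hW : DegLE W c) (h : c ≤ d) : DegLE W d :=
  fun j hj => hW j (h.trans_lt hj)

theorem degLE_X_pow (d : ℕ) : DegLE (X ^ d : S⟦X⟧) d := by
  intro j hj
  rw [coeff_X_pow, if_neg hj.ne']

theorem degLE_one (d : ℕ) : DegLE (1 : S⟦X⟧) d := by
  intro j hj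
  rw [coeff_one, if_neg (by omega)]

/-- A power series quotient of polynomials of degrees `u` and `v` is a polynomial as soon as the
first `v` coefficients of order larger than `u - v` vanish. -/
theorem DegLE.of_mul {V W : S⟦X⟧} {u v : ℕ} (hvu : v ≤ u) (hV : DegLE V v)
    (hV0 : constantCoeff V = 1)
    (hVW : DegLE (V * W) u) (hW : ∀ j, u - v < j → j ≤ u → coeff j W = 0) : DegLE W (u - v) := by
  intro j
  induction j using Nat.strong_induction_on with
  | _ j ih =>
    intro hj
    rcases le_or_gt j u with h | h
    · exact hW j hj h
    -- In order `j > u` only `V_0 W_j` survives: the other terms involve `V_a` with `a > v`, or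
    -- `W_b` with `u - v < b < j`, which vanishes by induction.
    have := hVW j h
    rw [coeff_mul, Finset.sum_eq_single (0, j)] at this
    · simpa [hV0] using this
    · rintro ⟨a, b⟩ hab hne
      rw [Finset.HasAntidiagonal.mem_antidiagonal] at hab
      simp only at hab ⊢
      rcases lt_or_ge v a with h' | h'
      · rw [hV a h', zero_mul]
      · have : a ≠ 0 := by rintro rfl; apply hne; simp at hab; simp [hab]
        rw [ih b (by omega) (by omega), mul_zero]
    · simp

/-- The additive map `δ` applied to the coefficients of power series. -/
noncomputable def coeffMap (δ : A →+ S) (W : A⟦X⟧) : S⟦X⟧ :=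
  PowerSeries.mk fun j => δ (coeff j W)

@[simp]
theorem coeff_coeffMap (δ : A →+ S) (W : A⟦X⟧) (j : ℕ) :
    coeff j (coeffMap δ W) = δ (coeff j W) :=
  coeff_mk _ _

/-- `δ` is a derivation along the ring homomorphism `π`. -/
def IsDerivationAlong (π : A →+* S) (δ : A →+ S) : Prop :=
  ∀ f g, δ (f * g) = π f * δ g + π g * δ f

variable {π : A →+* S} {δ : A →+ S}

theorem IsDerivationAlong.apply_one (h : IsDerivationAlong π δ) : δ 1 = 0 := by
  have := h 1 1
  simpa using this

theorem IsDerivationAlong.coeffMap_mul (h : IsDerivationAlong π δ) (W Z : A⟦X⟧) :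
    coeffMap δ (W * Z) =
      PowerSeries.map π W * coeffMap δ Z + PowerSeries.map π Z * coeffMap δ W := by
  ext j
  rw [mul_comm (PowerSeries.map π Z)]
  simp only [coeff_coeffMap, map_add, coeff_mul, map_sum, h _ _, coeff_map,
    Finset.sum_add_distrib]
  congr 1
  exact Finset.sum_congr rfl fun _ _ => mul_comm _ _

theorem IsDerivationAlong.coeffMap_one (h : IsDerivationAlong π δ) :
    coeffMap δ (1 : A⟦X⟧) = 0 := by
  ext j
  rw [coeff_coeffMap, coeff_one]
  split_ifs <;> simp [h.apply_one]

theorem IsDerivationAlong.coeffMap_pow (h : IsDerivationAlong π δ) (W : A⟦X⟧) (k : ℕ) :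
    coeffMap δ (W ^ k) = (k : S⟦X⟧) * PowerSeries.map π W ^ (k - 1) * coeffMap δ W := by
  induction k with
  | zero => simp [h.coeffMap_one]
  | succ k ih =>
    rw [pow_succ, h.coeffMap_mul, ih]
    cases k with
    | zero => simp
    | succ k => simp [pow_succ]; ring

theorem coeffMap_sub (W Z : A⟦X⟧) : coeffMap δ (W - Z) = coeffMap δ W - coeffMap δ Z := by
  ext j; simp

/-- The derivative of an inverse. -/
theorem IsDerivationAlong.coeffMap_of_mul_eq_one (h : IsDerivationAlong π δ) {W Z : A⟦X⟧}
    (hWZ : W * Z = 1) :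
    coeffMap δ Z = - (PowerSeries.map π Z ^ 2 * coeffMap δ W) := by
  have h1 := h.coeffMap_mul W Z
  rw [hWZ, h.coeffMap_one] at h1
  have h2 : PowerSeries.map π W * PowerSeries.map π Z = 1 := by rw [← map_mul, hWZ, map_one]
  linear_combination (-PowerSeries.map π Z) * h1 - coeffMap δ Z * h2

variable {σ : Type*} [Fintype σ]

/-- The derivation `∑ x_i ∂_i` along `π`. -/
def tangent (D : σ → Derivation ℤ A A) (π : A →+* S) (x : σ → S) : A →+ S where
  toFun f := ∑ i, x i * π (D i f)
  map_zero' := by simp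
  map_add' f g := by simp [mul_add, Finset.sum_add_distrib]

theorem tangent_apply (D : σ → Derivation ℤ A A) (π : A →+* S) (x : σ → S) (f : A) :
    tangent D π x f = ∑ i, x i * π (D i f) :=
  rfl

theorem isDerivationAlong_tangent (D : σ → Derivation ℤ A A) (π : A →+* S) (x : σ → S) :
    IsDerivationAlong π (tangent D π x) := by
  intro f g
  simp only [tangent_apply, Derivation.leibniz, smul_eq_mul, map_add, map_mul, mul_add,
    Finset.sum_add_distrib, Finset.mul_sum]
  congr 1 <;> exact Finset.sum_congr rfl fun _ _ => by ring

/-- A derivation along `π` which kills generators of an ideal that `π` kills, kills the ideal. -/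
theorem IsDerivationAlong.eq_zero_of_mem_span (h : IsDerivationAlong π δ) {G : Set A}
    (hπ : ∀ g ∈ G, π g = 0) (hδ : ∀ g ∈ G, δ g = 0) {f : A} (hf : f ∈ Ideal.span G) :
    δ f = 0 := by
  have hπ' : ∀ g ∈ Ideal.span G, π g = 0 := fun g hg =>
    (Ideal.span_le (I := RingHom.ker π)).2 hπ hg
  induction hf using Submodule.span_induction with
  | mem g hg => exact hδ g hg
  | zero => exact map_zero δ
  | add f g _ _ hf hg => rw [map_add, hf, hg, add_zero]
  | smul a f hf h0 => rw [smul_eq_mul, h, h0, hπ' f hf]; simp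

end Series

/-! ### Jacobian extensions for a family of derivations -/

section Extension

variable {A : Type*} [CommRing A] {σ : Type*}

/-- The Jacobian extension with respect to a family of derivations of a commutative ring. -/
def jacExt (D : σ → Derivation ℤ A A) (k : ℕ) (J : Ideal A) : Ideal A :=
  J ⊔ Ideal.span {δ | ∃ (f : Fin k → J) (x : Fin k → σ),
    δ = (Matrix.of fun i j => D (x j) (f i : A)).det}

variable {D : σ → Derivation ℤ A A} {J : Ideal A}

theorem le_jacExt (k : ℕ) : J ≤ jacExt D k J :=
  le_sup_left

theorem det_mem_jacExt {κ : Type*} [Fintype κ] [DecidableEq κ] {k : ℕ} (hk : Fintype.card κ = k)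
    (f : κ → A) (hf : ∀ i, f i ∈ J) (c : κ → σ) :
    (Matrix.of fun i j => D (c j) (f i)).det ∈ jacExt D k J := by
  subst hk
  let e := Fintype.equivFin κ
  refine Ideal.mem_sup_right (Ideal.subset_span
    ⟨fun i => ⟨f (e.symm i), hf _⟩, fun j => c (e.symm j), ?_⟩)
  rw [← Matrix.det_submatrix_equiv_self e.symm]
  rfl

theorem jacExt_le {k : ℕ} {K : Ideal A} (hJ : J ≤ K)
    (h : ∀ (f : Fin k → J) (x : Fin k → σ), (Matrix.of fun i j => D (x j) (f i : A)).det ∈ K) :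
    jacExt D k J ≤ K := by
  refine sup_le hJ (Ideal.span_le.2 ?_)
  rintro _ ⟨f, x, rfl⟩
  exact h f x

/-- Laplace expansion along the first row. -/
theorem jacExt_succ_le (k : ℕ) : jacExt D (k + 1) J ≤ jacExt D k J := by
  refine jacExt_le (le_jacExt k) fun f x => ?_
  rw [Matrix.det_succ_row_zero]
  refine Ideal.sum_mem _ fun j _ => Ideal.mul_mem_left _ _ ?_
  exact det_mem_jacExt (Fintype.card_fin k) (fun i : Fin k => (f i.succ : A))
    (fun i => (f i.succ).2) fun i => x (j.succAbove i)

theorem jacExt_anti : Antitone fun k => jacExt D k J :=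
  antitone_nat_of_succ_le jacExt_succ_le

end Extension

open PowerSeries

universe w

/-! ### Charts, their points and their tangent vectors -/

section Chart

variable {A : Type w} [CommRing A] {σ : Type} [Fintype σ]

/-- The relations which say that `U` and `V` are polynomials of degrees at most `u` and `v` with
`U ^ α * V ^ β = 1`. -/
def relations (U V : A⟦X⟧) (u v α β : ℕ) : Set A :=
  ({f | ∃ j, u < j ∧ f = coeff j U} ∪ {f | ∃ j, v < j ∧ f = coeff j V}) ∪
    {f | ∃ j, f = coeff j (U ^ α * V ^ β - 1)}

theorem map_relations_eq_zero_iff {S : Type*} [CommRing S] (π : A →+* S) {U V : A⟦X⟧}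
    {u v α β : ℕ} :
    (∀ f ∈ relations U V u v α β, π f = 0) ↔
      DegLE (PowerSeries.map π U) u ∧ DegLE (PowerSeries.map π V) v ∧
        PowerSeries.map π U ^ α * PowerSeries.map π V ^ β = 1 := by
  constructor
  · intro h
    refine ⟨fun j hj => ?_, fun j hj => ?_, ?_⟩
    · rw [coeff_map, h _ (Or.inl (Or.inl ⟨j, hj, rfl⟩))]
    · rw [coeff_map, h _ (Or.inl (Or.inr ⟨j, hj, rfl⟩))]
    · rw [← sub_eq_zero, ← map_pow, ← map_pow, ← map_mul, ← map_one (PowerSeries.map π), ← map_sub]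
      ext j
      rw [coeff_map, h _ (Or.inr ⟨j, rfl⟩), map_zero]
  · rintro ⟨hU, hV, hUV⟩ f ((⟨j, hj, rfl⟩ | ⟨j, hj, rfl⟩) | ⟨j, rfl⟩)
    · rw [← coeff_map, hU j hj]
    · rw [← coeff_map, hV j hj]
    · rw [← coeff_map, map_sub, map_mul, map_pow, map_pow, hUV, map_one, sub_self, map_zero]

/-- The ideal `J` is the ideal of a subscheme which is identified by the coefficients of `U` and `V`
with the scheme of pairs of polynomials of degrees at most `u` and `v` with constant coefficient
`1` such that `U ^ α * V ^ β = 1`; moreover the coefficients of `U` and `V` are coordinates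
transversally to `J`, in the sense that a tangent vector is determined by its effect on `U` and
`V`, and that every pair of polynomials of degrees at most `u` and `v` without constant coefficient
occurs. -/
structure Chart [IsLocalRing A] (D : σ → Derivation ℤ A A) (J : Ideal A) (U V : A⟦X⟧)
    (u v α β : ℕ) : Prop where
  constantCoeff_left : constantCoeff U = 1
  constantCoeff_right : constantCoeff V = 1
  residue_left : PowerSeries.map (IsLocalRing.residue A) U = 1
  residue_right : PowerSeries.map (IsLocalRing.residue A) V = 1
  left_ne_zero : α ≠ 0
  right_ne_zero : β ≠ 0
  eq_span : J = Ideal.span (relations U V u v α β)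
  existsUnique_tangent : ∀ (S : Type w) [CommRing S] (π : A →+* S), (∀ f ∈ J, π f = 0) →
    ∀ U' V' : S⟦X⟧, constantCoeff U' = 0 → constantCoeff V' = 0 → DegLE U' u → DegLE V' v →
      ∃! x : σ → S, coeffMap (tangent D π x) U = U' ∧ coeffMap (tangent D π x) V = V'

/-- The coefficients of `W` of the `v` orders up to `u`. -/
def window (W : A⟦X⟧) (u v : ℕ) : Set A :=
  {f | ∃ j, u - v < j ∧ j ≤ u ∧ f = coeff j W}

namespace Chart

variable [IsLocalRing A] {D : σ → Derivation ℤ A A} {J : Ideal A} {U V : A⟦X⟧} {u v α β : ℕ}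

theorem symm (h : Chart D J U V u v α β) : Chart D J V U v u β α where
  constantCoeff_left := h.constantCoeff_right
  constantCoeff_right := h.constantCoeff_left
  residue_left := h.residue_right
  residue_right := h.residue_left
  left_ne_zero := h.right_ne_zero
  right_ne_zero := h.left_ne_zero
  eq_span := by
    rw [h.eq_span, relations, relations, Set.union_comm {f | ∃ j, u < j ∧ f = coeff j U},
      mul_comm (U ^ α)]
  existsUnique_tangent S _ π hπ U' V' hU hV hU' hV' := by
    simpa only [and_comm] using h.existsUnique_tangent S π hπ V' U' hV hU hV' hU'

theorem mul_inv (h : Chart D J U V u v α β) : V * invOfUnit V 1 = 1 :=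
  mul_invOfUnit V 1 (by simpa using h.constantCoeff_right)

theorem mul_quotient (h : Chart D J U V u v α β) : V * (U * invOfUnit V 1) = U := by
  rw [mul_left_comm, h.mul_inv, mul_one]

section Point

variable {S : Type w} [CommRing S] {π : A →+* S}

/-- The functor of points of the subscheme. Ideals are compared below by evaluating the relations of
one in the quotient by the other. -/
theorem forall_map_eq_zero_iff (h : Chart D J U V u v α β) :
    (∀ f ∈ J, π f = 0) ↔
      DegLE (PowerSeries.map π U) u ∧ DegLE (PowerSeries.map π V) v ∧
        PowerSeries.map π U ^ α * PowerSeries.map π V ^ β = 1 := by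
  rw [← map_relations_eq_zero_iff]
  constructor
  · intro hf f hm
    exact hf f (h.eq_span ▸ Ideal.subset_span hm)
  · intro hf
    have : J ≤ RingHom.ker π := h.eq_span ▸ Ideal.span_le.2 hf
    exact this

theorem constantCoeff_coeffMap_left (h : Chart D J U V u v α β) (x : σ → S) :
    constantCoeff (coeffMap (tangent D π x) U) = 0 := by
  rw [← coeff_zero_eq_constantCoeff_apply, coeff_coeffMap, coeff_zero_eq_constantCoeff_apply,
    h.constantCoeff_left, (isDerivationAlong_tangent D π x).apply_one]

/-- The tangent vectors to the subscheme defined by `J`. -/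
theorem forall_tangent_eq_zero_iff (h : Chart D J U V u v α β) (hπ : ∀ f ∈ J, π f = 0)
    (x : σ → S) :
    (∀ f ∈ J, tangent D π x f = 0) ↔
      DegLE (coeffMap (tangent D π x) U) u ∧ DegLE (coeffMap (tangent D π x) V) v ∧
        (α : S⟦X⟧) * PowerSeries.map π V * coeffMap (tangent D π x) U +
          (β : S⟦X⟧) * PowerSeries.map π U * coeffMap (tangent D π x) V = 0 := by
  have hδ := isDerivationAlong_tangent D π x
  have hUV := (h.forall_map_eq_zero_iff.1 hπ).2.2
  set δ := tangent D π x
  obtain ⟨a, rfl⟩ := Nat.exists_eq_succ_of_ne_zero h.left_ne_zero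
  obtain ⟨b, rfl⟩ := Nat.exists_eq_succ_of_ne_zero h.right_ne_zero
  have hpow : coeffMap δ (U ^ (a + 1) * V ^ (b + 1) - 1) =
      PowerSeries.map π U ^ a * PowerSeries.map π V ^ b *
        (((a + 1 : ℕ) : S⟦X⟧) * PowerSeries.map π V * coeffMap δ U +
          ((b + 1 : ℕ) : S⟦X⟧) * PowerSeries.map π U * coeffMap δ V) := by
    rw [coeffMap_sub, hδ.coeffMap_one, hδ.coeffMap_mul, hδ.coeffMap_pow, hδ.coeffMap_pow,
      map_pow, map_pow, Nat.add_sub_cancel, Nat.add_sub_cancel]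
    ring
  -- The derivative of `U ^ α * V ^ β` carries the factor `U ^ (α - 1) * V ^ (β - 1)`, invertible
  -- because `U ^ α * V ^ β = 1` at the point.
  have hunit : IsUnit (PowerSeries.map π U ^ a * PowerSeries.map π V ^ b) :=
    IsUnit.of_mul_eq_one (PowerSeries.map π U * PowerSeries.map π V) (by
      rw [← hUV, Nat.succ_eq_add_one, Nat.succ_eq_add_one]; ring)
  constructor
  · intro hf
    refine ⟨fun j hj => ?_, fun j hj => ?_, ?_⟩
    · rw [coeff_coeffMap]
      exact hf _ (h.eq_span ▸ Ideal.subset_span (Or.inl (Or.inl ⟨j, hj, rfl⟩)))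
    · rw [coeff_coeffMap]
      exact hf _ (h.eq_span ▸ Ideal.subset_span (Or.inl (Or.inr ⟨j, hj, rfl⟩)))
    · rw [← hunit.mul_right_eq_zero, ← hpow]
      ext j
      rw [coeff_coeffMap, map_zero]
      exact hf _ (h.eq_span ▸ Ideal.subset_span (Or.inr ⟨j, rfl⟩))
  · rintro ⟨hU, hV, h0⟩ f hf
    rw [h0, mul_zero] at hpow
    rw [h.eq_span] at hf
    refine hδ.eq_zero_of_mem_span (fun g hg => hπ g (h.eq_span ▸ Ideal.subset_span hg)) ?_ hf
    rintro g ((⟨j, hj, rfl⟩ | ⟨j, hj, rfl⟩) | ⟨j, rfl⟩)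
    · rw [← coeff_coeffMap, hU j hj]
    · rw [← coeff_coeffMap, hV j hj]
    · rw [← coeff_coeffMap, hpow, map_zero]

/-- Where `V` divides `U`, there are `v` independent tangent vectors to the subscheme. -/
theorem exists_tangent (h : Chart D J U V u v α β) (hvu : v ≤ u) (hπ : ∀ f ∈ J, π f = 0)
    (hq : DegLE (PowerSeries.map π (U * invOfUnit V 1)) (u - v)) (i : Fin v) :
    ∃ x : σ → S, (∀ f ∈ J, tangent D π x f = 0) ∧
      coeffMap (tangent D π x) V = C (α : S) * X ^ ((i : ℕ) + 1) := by
  -- The tangent equation is solved by `V' = α t ^ (i + 1)` and `U' = -β (U/V) t ^ (i + 1)`, without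
  -- dividing by `α`; the degree of `U'` is at most `(u - v) + v`.
  obtain ⟨x, ⟨hU, hV⟩, -⟩ := h.existsUnique_tangent S π hπ
    (C (-β : S) * (PowerSeries.map π (U * invOfUnit V 1) * X ^ ((i : ℕ) + 1)))
    (C (α : S) * X ^ ((i : ℕ) + 1)) (by simp) (by simp)
    (((hq.mul (degLE_X_pow _)).mono (by omega)).C_mul _)
    (((degLE_X_pow _).mono (by omega)).C_mul _)
  refine ⟨x, (h.forall_tangent_eq_zero_iff hπ x).2 ?_, hV⟩
  rw [hU, hV]
  refine ⟨((hq.mul (degLE_X_pow _)).mono (by omega)).C_mul _,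
    ((degLE_X_pow _).mono (by omega)).C_mul _, ?_⟩
  have : PowerSeries.map π V * PowerSeries.map π (U * invOfUnit V 1) = PowerSeries.map π U := by
    rw [← map_mul, h.mul_quotient]
  rw [← this, map_neg, map_natCast, map_natCast]
  ring

end Point

theorem map_quotient_degLE {S : Type w} [CommRing S] {π : A →+* S}
    (h : Chart D J U V u v α β) (hvu : v ≤ u)
    (hπ : ∀ f ∈ J, π f = 0) (hw : ∀ f ∈ window (U * invOfUnit V 1) u v, π f = 0) :
    DegLE (PowerSeries.map π (U * invOfUnit V 1)) (u - v) := by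
  obtain ⟨hU, hV, -⟩ := h.forall_map_eq_zero_iff.1 hπ
  refine DegLE.of_mul (V := PowerSeries.map π V) hvu hV ?_ ?_ fun j hj hj' => ?_
  · rw [← coeff_zero_eq_constantCoeff_apply, coeff_map, coeff_zero_eq_constantCoeff_apply,
      h.constantCoeff_right, map_one]
  · rwa [← map_mul, h.mul_quotient]
  · rw [coeff_map, hw _ ⟨j, hj, hj', rfl⟩]

end Chart

end Chart

/-! ### The critical extension of a chart -/

namespace Chart

variable {A : Type w} [CommRing A] {σ : Type} [Fintype σ] [IsLocalRing A]
  {D : σ → Derivation ℤ A A} {J : Ideal A} {U V : A⟦X⟧} {u v α β : ℕ}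

theorem map_residue_eq_zero (h : Chart D J U V u v α β) :
    ∀ f ∈ J, IsLocalRing.residue A f = 0 := by
  rw [h.forall_map_eq_zero_iff, h.residue_left, h.residue_right]
  exact ⟨degLE_one u, degLE_one v, by simp⟩

theorem ne_top (h : Chart D J U V u v α β) : J ≠ ⊤ := by
  intro hJ
  have := h.map_residue_eq_zero 1 (hJ ▸ Submodule.mem_top)
  simp at this

theorem residue_quotient (h : Chart D J U V u v α β) :
    PowerSeries.map (IsLocalRing.residue A) (U * invOfUnit V 1) = 1 := by
  have h1 := congrArg (PowerSeries.map (IsLocalRing.residue A)) h.mul_quotient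
  rwa [map_mul, h.residue_left, h.residue_right, one_mul] at h1

/-- Passing from `(U, V)` to `(U / V, V)` on the locus where `V` divides `U`. -/
theorem quotient (h : Chart D J U V u v α β) (hvu : v ≤ u) :
    Chart D (J ⊔ Ideal.span (window (U * invOfUnit V 1) u v)) (U * invOfUnit V 1) V (u - v) v α
      (α + β) where
  constantCoeff_left := by
    have := congrArg constantCoeff h.mul_quotient
    rwa [map_mul, h.constantCoeff_right, h.constantCoeff_left, one_mul] at this
  constantCoeff_right := h.constantCoeff_right
  residue_left := h.residue_quotient
  residue_right := h.residue_right
  left_ne_zero := h.left_ne_zero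
  right_ne_zero := by have := h.left_ne_zero; omega
  eq_span := by
    have hmul : ∀ {S : Type w} [CommRing S] (π : A →+* S), PowerSeries.map π U =
        PowerSeries.map π V * PowerSeries.map π (U * invOfUnit V 1) := fun π => by
      rw [← map_mul, h.mul_quotient]
    -- Each inclusion is tested in the quotient by the larger ideal, where `U = V * (U/V)` turns `U
    -- ^ α * V ^ β` into `(U/V) ^ α * V ^ (α + β)`.
    apply le_antisymm
    · set K := Ideal.span (relations (U * invOfUnit V 1) V (u - v) v α (α + β))
      obtain ⟨hU, hV, hUV⟩ := (map_relations_eq_zero_iff (Ideal.Quotient.mk K)).1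
        fun f hf => Ideal.Quotient.eq_zero_iff_mem.2 (Ideal.subset_span hf)
      refine sup_le (fun f hf => ?_) (Ideal.span_le.2 ?_)
      · rw [← Ideal.Quotient.eq_zero_iff_mem]
        revert f
        rw [h.forall_map_eq_zero_iff, hmul]
        refine ⟨(hV.mul hU).mono (by omega), hV, ?_⟩
        rw [← hUV]
        ring
      · rintro _ ⟨j, hj, -, rfl⟩
        exact Ideal.subset_span (Or.inl (Or.inl ⟨j, hj, rfl⟩))
    · set K := J ⊔ Ideal.span (window (U * invOfUnit V 1) u v)
      have hJ : ∀ f ∈ J, Ideal.Quotient.mk K f = 0 := fun f hf =>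
        Ideal.Quotient.eq_zero_iff_mem.2 (Ideal.mem_sup_left hf)
      have hW := h.map_quotient_degLE hvu hJ fun f hf =>
        Ideal.Quotient.eq_zero_iff_mem.2 (Ideal.mem_sup_right (Ideal.subset_span hf))
      obtain ⟨-, hV, hUV⟩ := h.forall_map_eq_zero_iff.1 hJ
      refine Ideal.span_le.2 fun f hf => ?_
      rw [SetLike.mem_coe, ← Ideal.Quotient.eq_zero_iff_mem]
      revert f
      rw [map_relations_eq_zero_iff]
      refine ⟨hW, hV, ?_⟩
      rw [← hUV, hmul]
      ring
  existsUnique_tangent S _ π hπ U' V' hU0 hV0 hU' hV' := by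
    have hJ : ∀ f ∈ J, π f = 0 := fun f hf => hπ f (Ideal.mem_sup_left hf)
    have hW := h.map_quotient_degLE hvu hJ fun f hf =>
      hπ f (Ideal.mem_sup_right (Ideal.subset_span hf))
    obtain ⟨-, hV, -⟩ := h.forall_map_eq_zero_iff.1 hJ
    have hinv : PowerSeries.map π V * PowerSeries.map π (invOfUnit V 1) = 1 := by
      rw [← map_mul, h.mul_inv, map_one]
    -- By Leibniz, prescribing the derivatives of `U/V` and `V` amounts to prescribing those of `U`
    -- and `V`, because `V` is an invertible series.
    obtain ⟨x, ⟨hxU, hxV⟩, huniq⟩ := h.existsUnique_tangent S π hJ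
      (PowerSeries.map π V * U' + PowerSeries.map π (U * invOfUnit V 1) * V') V'
      (by simp [hU0, hV0]) hV0
      (((hV.mul hU').mono (by omega)).add ((hW.mul hV').mono (by omega))) hV'
    have hδ : ∀ y : σ → S, coeffMap (tangent D π y) U =
        PowerSeries.map π V * coeffMap (tangent D π y) (U * invOfUnit V 1) +
          PowerSeries.map π (U * invOfUnit V 1) * coeffMap (tangent D π y) V := fun y => by
      rw [← (isDerivationAlong_tangent D π y).coeffMap_mul, h.mul_quotient]
    refine ⟨x, ⟨?_, hxV⟩, ?_⟩
    · have := hδ x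
      rw [hxU, hxV, add_left_inj] at this
      linear_combination (-PowerSeries.map π (invOfUnit V 1)) * this +
        (U' - coeffMap (tangent D π x) (U * invOfUnit V 1)) * hinv
    · rintro y ⟨hyU, hyV⟩
      refine huniq y ⟨?_, hyV⟩
      rw [hδ, hyU, hyV]

/-- Modulo the right-hand side `V` divides `U`, so `v` tangent vectors annihilate every row of the
Jacobian matrix. The differentials of the coefficients of `V`, divided by `α`, form the left inverse
required by `det_submatrix_eq_zero_of_mul_eq_zero`. -/
theorem jacExt_le_sup_window (hA : ∀ k : ℕ, k ≠ 0 → IsUnit (k : A))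
    (h : Chart D J U V u v α β) (hvu : v ≤ u) {k : ℕ} (hk : k + v = Fintype.card σ + 1) :
    jacExt D k J ≤ J ⊔ Ideal.span (window (U * invOfUnit V 1) u v) := by
  classical
  set K := J ⊔ Ideal.span (window (U * invOfUnit V 1) u v)
  have hJ : ∀ f ∈ J, Ideal.Quotient.mk K f = 0 := fun f hf =>
    Ideal.Quotient.eq_zero_iff_mem.2 (Ideal.mem_sup_left hf)
  have hW := h.map_quotient_degLE hvu hJ fun f hf =>
    Ideal.Quotient.eq_zero_iff_mem.2 (Ideal.mem_sup_right (Ideal.subset_span hf))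
  choose x hxJ hxV using h.exists_tangent hvu hJ hW
  obtain ⟨a, ha⟩ := ((hA α h.left_ne_zero).map (Ideal.Quotient.mk K)).exists_left_inv
  rw [map_natCast] at ha
  refine jacExt_le le_sup_left fun f c => ?_
  rw [← Ideal.Quotient.eq_zero_iff_mem, RingHom.map_det]
  have hmin := det_submatrix_eq_zero_of_mul_eq_zero (by simpa using hk)
    (Matrix.of fun (i : Fin k) s => Ideal.Quotient.mk K (D s (f i : A)))
    (Matrix.of fun s (i : Fin v) => x i s)
    (Matrix.of fun (i : Fin v) s => a * Ideal.Quotient.mk K (D s (coeff ((i : ℕ) + 1) V)))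
    ?_ ?_ c
  · exact hmin
  · ext i j
    have := hxJ j _ (f i).2
    rw [tangent_apply] at this
    simpa [Matrix.mul_apply, mul_comm] using this
  · ext i j
    have := congrArg (coeff ((i : ℕ) + 1)) (hxV j)
    rw [coeff_coeffMap, tangent_apply, coeff_C_mul, coeff_X_pow] at this
    rw [Matrix.mul_apply, Matrix.one_apply]
    have h2 : ∑ s, a * Ideal.Quotient.mk K (D s (coeff ((i : ℕ) + 1) V)) * x j s =
        a * ((α : A ⧸ K) * if (i : ℕ) + 1 = (j : ℕ) + 1 then 1 else 0) := by
      rw [← this, Finset.mul_sum]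
      exact Finset.sum_congr rfl fun _ _ => by ring
    simp only [Matrix.of_apply]
    rw [h2, ← mul_assoc, ha, one_mul]
    simp [Fin.ext_iff]

/-- There are as many functions in `J` with independent differentials as the `v` independent
tangent vectors at the closed point allow, and the coefficients of `V` complete them. -/
theorem exists_frame (hA : ∀ k : ℕ, k ≠ 0 → IsUnit (k : A))
    (h : Chart D J U V u v α β) (hvu : v ≤ u) :
    ∃ (k : ℕ) (f : Fin k → A) (c : Fin k → σ) (c' : Fin k ⊕ Fin v → σ),
      k + v = Fintype.card σ ∧ (∀ i, f i ∈ J) ∧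
      IsUnit (Matrix.of fun i j => D (c j) (f i)).det ∧
      IsUnit (Matrix.of fun i j => D (c' j)
        (Sum.elim f (fun i : Fin v => coeff ((i : ℕ) + 1) V) i)).det := by
  classical
  let π : A →+* IsLocalRing.ResidueField A := IsLocalRing.residue A
  have hJ : ∀ f ∈ J, π f = 0 := h.map_residue_eq_zero
  have hα : (α : IsLocalRing.ResidueField A) ≠ 0 := by
    have := (hA α h.left_ne_zero).map π
    rw [map_natCast] at this
    exact this.ne_zero
  let d : A → σ → IsLocalRing.ResidueField A := fun f s => π (D s f)
  have hd : ∀ (x : σ → IsLocalRing.ResidueField A) (f : A),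
      tangent D π x f = ∑ s, x s * d f s := fun _ _ => rfl
  have hq : DegLE (PowerSeries.map π (U * invOfUnit V 1)) (u - v) := by
    rw [h.residue_quotient]
    exact degLE_one _
  choose x hxJ hxV using h.exists_tangent hvu hJ hq
  -- A basis of the span of the differentials at the closed point of the elements of `J`.
  obtain ⟨ι, a, ha, hspan, hli⟩ :=
    exists_linearIndependent' (IsLocalRing.ResidueField A) fun f : J => d f
  have : Finite ι := hli.finite
  let b : Fin (Nat.card ι) → J := a ∘ (Finite.equivFin ι).symm
  have hbspan : Submodule.span (IsLocalRing.ResidueField A) (Set.range fun i => d (b i)) =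
      Submodule.span (IsLocalRing.ResidueField A) (Set.range fun f : J => d f) := by
    rw [← hspan]
    exact congrArg _ ((Finite.equivFin ι).symm.surjective.range_comp fun i => d (a i))
  have hbli : LinearIndependent (IsLocalRing.ResidueField A) fun i => d (b i) :=
    hli.comp _ (Finite.equivFin ι).symm.injective
  let g : Fin (Nat.card ι) ⊕ Fin v → σ → IsLocalRing.ResidueField A :=
    fun i => d (Sum.elim (fun i => (b i : A)) (fun i : Fin v => coeff ((i : ℕ) + 1) V) i)
  have hgli : LinearIndependent (IsLocalRing.ResidueField A) g := by
    rw [Fintype.linearIndependent_iff]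
    -- Pairing a linear relation with the tangent vector `x i` kills the differentials from `J` and
    -- isolates `α` times the coefficient of the `i`-th coefficient of `V`.
    intro e he
    have hr : ∀ i, e (Sum.inr i) = 0 := by
      intro i
      have h1 : ∑ s, x i s * (∑ j, e j • g j) s = 0 := by rw [he]; simp
      have h2 : ∑ s, x i s * (∑ j, e j • g j) s = ∑ j, e j * ∑ s, x i s * g j s := by
        simp only [Finset.sum_apply, Pi.smul_apply, smul_eq_mul, Finset.mul_sum]
        rw [Finset.sum_comm]
        exact Finset.sum_congr rfl fun _ _ => Finset.sum_congr rfl fun _ _ => by ring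
      rw [h2, Fintype.sum_sum_type, Finset.sum_eq_zero, zero_add, Finset.sum_eq_single i] at h1
      · have h3 := congrArg (coeff ((i : ℕ) + 1)) (hxV i)
        rw [coeff_coeffMap, hd, coeff_C_mul, coeff_X_pow, if_pos rfl, mul_one] at h3
        simp only [g, Sum.elim_inr, h3] at h1
        exact (mul_eq_zero.1 h1).resolve_right hα
      · intro j _ hj
        have h3 := congrArg (coeff ((j : ℕ) + 1)) (hxV i)
        rw [coeff_coeffMap, hd, coeff_C_mul, coeff_X_pow,
          if_neg (by simpa [Fin.ext_iff] using hj), mul_zero] at h3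
        simp only [g, Sum.elim_inr, h3, mul_zero]
      · simp
      · intro j _
        have h3 := hxJ i _ (b j).2
        rw [hd] at h3
        simp only [g, Sum.elim_inl, h3, mul_zero]
    have hl : ∀ i, e (Sum.inl i) = 0 := by
      rw [Fintype.linearIndependent_iff] at hbli
      refine hbli (fun i => e (Sum.inl i)) ?_
      simpa [Fintype.sum_sum_type, hr, g] using he
    rintro (i | i)
    exacts [hl i, hr i]
  have hgspan : ⊤ ≤ Submodule.span (IsLocalRing.ResidueField A) (Set.range g) := by
    by_contra hlt
    -- A functional vanishing on the frame is a tangent vector with `V' = 0`; as `U = V = 1` at the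
    -- closed point, the tangent equation gives `U' = 0`, and uniqueness in the chart makes it zero.
    obtain ⟨φ, hφ, hker⟩ := Submodule.exists_le_ker_of_lt_top _
      (lt_top_iff_ne_top.2 fun h => hlt h.ge)
    have hφg : ∀ i, φ (g i) = 0 := fun i => hker (Submodule.subset_span ⟨i, rfl⟩)
    let y : σ → IsLocalRing.ResidueField A := fun s => φ (Pi.single s 1)
    have hy : ∀ z : σ → IsLocalRing.ResidueField A, φ z = ∑ s, y s * z s := fun z => by
      rw [LinearMap.pi_apply_eq_sum_univ]
      exact Finset.sum_congr rfl fun s _ => by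
        rw [smul_eq_mul, mul_comm]
        congr 2
        ext t
        simp [Pi.single_apply, eq_comm]
    have hyJ : ∀ f ∈ J, tangent D π y f = 0 := by
      intro f hf
      rw [hd, ← hy]
      have hmem : d f ∈
          Submodule.span (IsLocalRing.ResidueField A) (Set.range fun i => d (b i)) := by
        rw [hbspan]
        exact Submodule.subset_span ⟨⟨f, hf⟩, rfl⟩
      have hle : Submodule.span (IsLocalRing.ResidueField A) (Set.range fun i => d (b i)) ≤
          LinearMap.ker φ := by
        rw [Submodule.span_le]
        rintro _ ⟨i, rfl⟩
        exact hφg (Sum.inl i)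
      exact hle hmem
    obtain ⟨hyU, hyV, hrel⟩ := (h.forall_tangent_eq_zero_iff hJ y).1 hyJ
    have hV0 : coeffMap (tangent D π y) V = 0 := by
      ext j
      rw [map_zero]
      rcases lt_or_ge v j with hj | hj
      · exact hyV j hj
      · rcases j with _ | j
        · exact (coeff_zero_eq_constantCoeff_apply _).trans (h.symm.constantCoeff_coeffMap_left y)
        · rw [coeff_coeffMap, hd, ← hy]
          exact hφg (Sum.inr ⟨j, hj⟩)
    have hU0 : coeffMap (tangent D π y) U = 0 := by
      have hrV : PowerSeries.map π V = 1 := h.residue_right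
      rw [hV0, mul_zero, add_zero, hrV, mul_one,
        ← map_natCast (C : IsLocalRing.ResidueField A →+* (IsLocalRing.ResidueField A)⟦X⟧) α] at hrel
      ext j
      have := congrArg (coeff j) hrel
      rw [coeff_C_mul, map_zero] at this
      exact (mul_eq_zero.1 this).resolve_left hα
    have hy0 : y = 0 := (h.existsUnique_tangent (IsLocalRing.ResidueField A) π hJ 0 0
      (map_zero _) (map_zero _)
      (fun j _ => map_zero _) fun j _ => map_zero _).unique ⟨hU0, hV0⟩
        ⟨by ext j; simp [tangent_apply], by ext j; simp [tangent_apply]⟩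
    exact hφ (LinearMap.ext fun z => by rw [hy, hy0]; simp)
  have hcard : Nat.card ι + v = Fintype.card σ := by
    have := Module.finrank_eq_card_basis (Module.Basis.mk hgli hgspan)
    simpa using this.symm
  obtain ⟨c, hc⟩ := exists_isUnit_det_submatrix (Matrix.of fun i => d (b i)) hbli
  obtain ⟨c', hc'⟩ := exists_isUnit_det_submatrix (Matrix.of g) hgli
  refine ⟨Nat.card ι, fun i => b i, c, c', hcard, fun i => (b i).2, ?_, ?_⟩
  -- The minors are units in the residue field, hence in the local ring `A`.
  · refine isUnit_of_map_unit π _ ?_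
    rw [RingHom.map_det]
    exact hc
  · refine isUnit_of_map_unit π _ ?_
    rw [RingHom.map_det]
    exact hc'

/-- The frame provides a unit minor of order `m - v`, and Jacobian extensions decrease with the
order. -/
theorem jacExt_eq_top (hA : ∀ k : ℕ, k ≠ 0 → IsUnit (k : A))
    (h : Chart D J U V u v α β) (hvu : v ≤ u) {k : ℕ} (hk : k + v ≤ Fintype.card σ) :
    jacExt D k J = ⊤ := by
  obtain ⟨l, f, c, -, hl, hf, hu, -⟩ := h.exists_frame hA hvu
  have hmem := det_mem_jacExt (Fintype.card_fin l) f hf c (D := D)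
  exact Ideal.eq_top_of_isUnit_mem _ (jacExt_anti (by omega : k ≤ l) hmem) hu

/-- Modulo `jacExt D k J` the differentials of `J` are spanned by the `m - v` from the frame, so a
vector field killing those is tangent to `J`. Choosing it with `V' = t ^ v` bounds the degree of
`U/V`. -/
theorem window_subset_jacExt (hA : ∀ k : ℕ, k ≠ 0 → IsUnit (k : A))
    (h : Chart D J U V u v α β) (hvu : v ≤ u) {k : ℕ} (hk : k + v = Fintype.card σ + 1) :
    window (U * invOfUnit V 1) u v ⊆ jacExt D k J := by
  classical
  rcases v.eq_zero_or_pos with rfl | hv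
  · rintro _ ⟨j, hj, hj', -⟩
    omega
  obtain ⟨l, f, c, c', hl, hf, hu, hu'⟩ := h.exists_frame hA hvu
  obtain rfl : k = l + 1 := by omega
  set K := jacExt D (l + 1) J
  let π := Ideal.Quotient.mk K
  have hJ : ∀ g ∈ J, π g = 0 := fun g hg =>
    Ideal.Quotient.eq_zero_iff_mem.2 (le_jacExt _ hg)
  let N : Matrix (Fin l ⊕ Fin v) (Fin l ⊕ Fin v) (A ⧸ K) := π.mapMatrix (Matrix.of fun i j =>
    D (c' j) (Sum.elim f (fun i : Fin v => coeff ((i : ℕ) + 1) V) i))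
  have hN : IsUnit N.det := by
    have := hu'.map π
    rwa [RingHom.map_det] at this
  -- The index of the coefficient of order `v` of `V`, the only frame function whose derivative
  -- along the sought vector is nonzero.
  let i₀ : Fin l ⊕ Fin v := Sum.inr ⟨v - 1, by omega⟩
  let y : Fin l ⊕ Fin v → A ⧸ K := Matrix.mulVec N⁻¹ (Pi.single i₀ 1)
  have hy : Matrix.mulVec N y = Pi.single i₀ 1 := by
    rw [Matrix.mulVec_mulVec, Matrix.mul_nonsing_inv _ hN, Matrix.one_mulVec]
  let x : σ → A ⧸ K := fun s => ∑ i, if c' i = s then y i else 0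
  have hx : ∀ g : A, tangent D π x g = ∑ i, π (D (c' i) g) * y i := by
    intro g
    simp only [tangent_apply, x, Finset.sum_mul]
    rw [Finset.sum_comm]
    refine Finset.sum_congr rfl fun i _ => ?_
    rw [Finset.sum_eq_single (c' i)]
    · rw [if_pos rfl, mul_comm]
    · intro s _ hs
      rw [if_neg hs.symm, zero_mul]
    · simp
  have hxN : ∀ i, tangent D π x (Sum.elim f (fun i : Fin v => coeff ((i : ℕ) + 1) V) i) =
      (Pi.single i₀ 1 : Fin l ⊕ Fin v → A ⧸ K) i := fun i => by
    rw [hx, ← hy]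
    rfl
  have hxf : ∀ i, tangent D π x (f i) = 0 := fun i => by
    simpa [i₀] using hxN (Sum.inl i)
  have hxJ : ∀ g ∈ J, tangent D π x g = 0 := by
    intro g hg
    -- The bordered minors have order `l + 1`, so they vanish modulo `K`.
    obtain ⟨m, hm⟩ := exists_vecMul_eq_of_bordered_minors
      (Matrix.of fun (i : Fin l) s => π (D s (f i))) c
      (by have := hu.map π; rwa [RingHom.map_det] at this) (fun s => π (D s g)) (fun s => by
        have hmem := det_mem_jacExt (D := D) (k := l + 1) (κ := Fin l ⊕ Unit) (by simp)
          (Sum.elim f fun _ => g) (by rintro (i | i); exacts [hf i, hg]) (Sum.elim c fun _ => s)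
        rw [← Ideal.Quotient.eq_zero_iff_mem, RingHom.map_det] at hmem
        rw [← hmem]
        congr 1
        ext i j
        rcases i with i | i <;> rfl)
    have hgs : ∀ s, π (D s g) = ∑ i, m i * π (D s (f i)) := fun s => (congrFun hm s).symm
    simp only [tangent_apply, hgs, Finset.mul_sum] at hxf ⊢
    rw [Finset.sum_comm]
    refine Finset.sum_eq_zero fun i _ => ?_
    rw [← mul_zero (m i), ← hxf i, Finset.mul_sum]
    exact Finset.sum_congr rfl fun _ _ => by ring
  obtain ⟨hxU, hxV, hrel⟩ := (h.forall_tangent_eq_zero_iff hJ x).1 hxJ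
  have hV : coeffMap (tangent D π x) V = X ^ v := by
    ext j
    rw [coeff_X_pow]
    rcases lt_or_ge v j with hj | hj
    · rw [hxV j hj, if_neg hj.ne']
    · rcases j with _ | j
      · rw [if_neg hv.ne]
        exact (coeff_zero_eq_constantCoeff_apply _).trans (h.symm.constantCoeff_coeffMap_left x)
      · have := hxN (Sum.inr ⟨j, hj⟩)
        rw [Sum.elim_inr] at this
        rw [coeff_coeffMap, this, Pi.single_apply]
        refine if_congr ?_ rfl rfl
        simp only [i₀, Sum.inr.injEq, Fin.mk.injEq]
        omega
  obtain ⟨b, hb⟩ := ((hA β h.right_ne_zero).map π).exists_left_inv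
  rw [map_natCast] at hb
  -- The tangent equation with `V' = t ^ v`, divided by `β V`; in orders above `u` the right-hand
  -- side vanishes.
  have hquot : PowerSeries.map π (U * invOfUnit V 1) * X ^ v =
      C (-(b * α)) * coeffMap (tangent D π x) U := by
    have hinv : PowerSeries.map π V * PowerSeries.map π (invOfUnit V 1) = 1 := by
      rw [← map_mul, h.mul_inv, map_one]
    have hbC : C b * (β : (A ⧸ K)⟦X⟧) = 1 := by
      rw [← map_natCast (C : (A ⧸ K) →+* (A ⧸ K)⟦X⟧) β, ← map_mul, hb, map_one]
    rw [hV] at hrel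
    rw [map_mul, map_neg, map_mul, map_natCast]
    linear_combination (C b * PowerSeries.map π (invOfUnit V 1)) * hrel -
      (C b * α * coeffMap (tangent D π x) U) * hinv -
      (PowerSeries.map π U * PowerSeries.map π (invOfUnit V 1) * X ^ v) * hbC
  rintro _ ⟨j, hj, -, rfl⟩
  rw [SetLike.mem_coe, ← Ideal.Quotient.eq_zero_iff_mem]
  have := congrArg (coeff (j + v)) hquot
  rwa [coeff_mul_X_pow, coeff_C_mul, hxU _ (by omega), mul_zero, coeff_map] at this

/-- The critical Jacobian extension adds the condition that `V` divides `U`. -/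
theorem jacExt_eq (hA : ∀ k : ℕ, k ≠ 0 → IsUnit (k : A))
    (h : Chart D J U V u v α β) (hvu : v ≤ u) {k : ℕ} (hk : k + v = Fintype.card σ + 1) :
    jacExt D k J = J ⊔ Ideal.span (window (U * invOfUnit V 1) u v) :=
  le_antisymm (h.jacExt_le_sup_window hA hvu hk)
    (sup_le (le_jacExt k) (Ideal.span_le.2 (h.window_subset_jacExt hA hvu hk)))

end Chart

/-! ### Repeated division by the same series -/

section Iterate

variable {A : Type w} [CommRing A] {σ : Type} [Fintype σ]

/-- The coefficients which have to vanish for `V ^ s` to divide `U`. -/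
def quotientConditions (U V : A⟦X⟧) (u v s : ℕ) : Set A :=
  {f | ∃ k < s * v, f = coeff (u - k) (U * invOfUnit V 1 ^ (k / v + 1))}

theorem window_eq {W : A⟦X⟧} {u v : ℕ} (hvu : v ≤ u) :
    window W u v = {f | ∃ k < v, f = coeff (u - k) W} := by
  ext f
  constructor
  · rintro ⟨j, hj, hj', rfl⟩
    exact ⟨u - j, by omega, by rw [Nat.sub_sub_self hj']⟩
  · rintro ⟨k, hk, rfl⟩
    exact ⟨u - k, by omega, by omega, rfl⟩

/-- The indices `s * v ≤ k < (s + 1) * v` have `k / v = s`; they are the conditions for dividing `U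
/ V ^ s` once more. -/
theorem quotientConditions_succ {U V : A⟦X⟧} {u v s : ℕ} (hs : (s + 1) * v ≤ u) :
    quotientConditions U V u v (s + 1) = quotientConditions U V u v s ∪
      window (U * invOfUnit V 1 ^ s * invOfUnit V 1) (u - s * v) v := by
  have hvu : v ≤ u - s * v := by rw [add_mul, one_mul] at hs; omega
  rw [window_eq hvu, mul_assoc, ← pow_succ]
  ext f
  constructor
  · rintro ⟨k, hk, rfl⟩
    rcases lt_or_ge k (s * v) with h | h
    · exact Or.inl ⟨k, h, rfl⟩
    · rw [add_mul, one_mul] at hk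
      obtain ⟨t, rfl⟩ := Nat.exists_eq_add_of_le h
      have hdiv : (s * v + t) / v = s := by
        rw [add_comm, Nat.add_mul_div_right _ _ (by omega), Nat.div_eq_of_lt (by omega), zero_add]
      exact Or.inr ⟨t, by omega, by rw [hdiv, Nat.sub_sub]⟩
  · rintro (⟨k, hk, rfl⟩ | ⟨t, ht, rfl⟩)
    · exact ⟨k, hk.trans_le (Nat.mul_le_mul_right v (Nat.le_succ s)), rfl⟩
    · refine ⟨s * v + t, by rw [add_mul, one_mul]; omega, ?_⟩
      have hdiv : (s * v + t) / v = s := by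
        rw [add_comm, Nat.add_mul_div_right _ _ (by omega), Nat.div_eq_of_lt (by omega), zero_add]
      rw [hdiv, Nat.sub_sub]

namespace Chart

variable [IsLocalRing A] {D : σ → Derivation ℤ A A} {J : Ideal A} {U V : A⟦X⟧} {u v α β : ℕ}

theorem le_card (hA : ∀ k : ℕ, k ≠ 0 → IsUnit (k : A)) (h : Chart D J U V u v α β)
    (hvu : v ≤ u) : v ≤ Fintype.card σ := by
  obtain ⟨k, _, _, _, hk, -⟩ := h.exists_frame hA hvu
  omega

/-- The critical order of the Jacobian extension. -/
theorem sInf_eq (hA : ∀ k : ℕ, k ≠ 0 → IsUnit (k : A)) (h : Chart D J U V u v α β)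
    (hvu : v ≤ u) : sInf {k | jacExt D k J ≠ ⊤} = Fintype.card σ + 1 - v := by
  have hv := h.le_card hA hvu
  have hmem : Fintype.card σ + 1 - v ∈ {k | jacExt D k J ≠ ⊤} := by
    rw [Set.mem_ofPred_eq, h.jacExt_eq hA hvu (by omega)]
    exact (h.quotient hvu).ne_top
  refine le_antisymm (Nat.sInf_le hmem) (le_csInf ⟨_, hmem⟩ fun k hk => ?_)
  by_contra hlt
  exact hk (h.jacExt_eq_top hA hvu (by omega))

theorem quotient_pow (h : Chart D J U V u v α β) (s : ℕ) (hs : s * v ≤ u) :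
    Chart D (J ⊔ Ideal.span (quotientConditions U V u v s)) (U * invOfUnit V 1 ^ s) V (u - s * v) v
      α (β + s * α) := by
  induction s with
  | zero =>
    have : quotientConditions U V u v 0 = ∅ := by
      ext f
      simp [quotientConditions]
    simpa [this] using h
  | succ s ih =>
    have hs' := hs
    rw [add_mul, one_mul] at hs'
    have := (ih (by omega)).quotient (by omega)
    rw [quotientConditions_succ hs, Ideal.span_union, ← sup_assoc, pow_succ, ← mul_assoc]
    convert this using 1
    · rw [add_mul, one_mul, Nat.sub_sub]
    · ring

theorem iterate_jacExt (hA : ∀ k : ℕ, k ≠ 0 → IsUnit (k : A)) (h : Chart D J U V u v α β)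
    (s : ℕ) (hs : s * v ≤ u) :
    (jacExt D (Fintype.card σ + 1 - v))^[s] J =
      J ⊔ Ideal.span (quotientConditions U V u v s) := by
  induction s with
  | zero =>
    have : quotientConditions U V u v 0 = ∅ := by
      ext f
      simp [quotientConditions]
    simp [this]
  | succ s ih =>
    have hs' := hs
    rw [add_mul, one_mul] at hs'
    have hc := h.quotient_pow s (by omega)
    have hv := hc.le_card hA (by omega)
    rw [Function.iterate_succ_apply', ih (by omega), hc.jacExt_eq hA (by omega) (by omega),
      quotientConditions_succ hs, Ideal.span_union, ← sup_assoc]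

end Chart

end Iterate

/-! ### The ring of germs -/

section GermRing

variable {σ : Type} [Fintype σ]

/-- The value of a germ at the origin. -/
noncomputable def germValue : analyticGerms σ →+* ℂ :=
  (Filter.Germ.valueRingHom (x := (0 : σ → ℂ))).comp (analyticGerms σ).subtype

theorem isUnit_of_germValue_ne_zero {g : analyticGerms σ} (hg : germValue g ≠ 0) : IsUnit g := by
  obtain ⟨_, f, hf, rfl⟩ := g
  have hf0 : f 0 ≠ 0 := hg
  refine IsUnit.of_mul_eq_one ⟨(f⁻¹ : (σ → ℂ) → ℂ), f⁻¹, hf.inv hf0, rfl⟩ (Subtype.ext ?_)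
  refine Filter.Germ.coe_eq.2 ?_
  filter_upwards [hf.continuousAt.eventually_ne hf0] with x hx
  exact mul_inv_cancel₀ hx

instance isLocalHom_germValue : IsLocalHom (germValue (σ := σ)) :=
  ⟨fun _ hg => isUnit_of_germValue_ne_zero hg.ne_zero⟩

instance isLocalRing_analyticGerms : IsLocalRing (analyticGerms σ) :=
  RingHom.domain_isLocalRing germValue

/-- Characteristic zero enters here: the exponents `α` and `β` of every chart are invertible. -/
theorem isUnit_natCast_analyticGerms (k : ℕ) (hk : k ≠ 0) : IsUnit (k : analyticGerms σ) :=
  isUnit_of_germValue_ne_zero (by rw [map_natCast]; exact_mod_cast hk)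

theorem residue_eq_zero_of_germValue {g : analyticGerms σ} (hg : germValue g = 0) :
    IsLocalRing.residue _ g = 0 := by
  rw [IsLocalRing.residue_eq_zero_iff, IsLocalRing.mem_maximalIdeal, mem_nonunits_iff]
  intro hu
  exact (hu.map germValue).ne_zero hg

/-- Taking germs of polynomials, as a ring homomorphism. -/
noncomputable def polyGermHom : MvPolynomial σ ℂ →+* analyticGerms σ where
  toFun := polyGerm
  map_one' := Subtype.ext (by simp [polyGerm]; rfl)
  map_zero' := Subtype.ext (by simp [polyGerm]; rfl)
  map_add' p q := Subtype.ext (by simp [polyGerm]; rfl)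
  map_mul' p q := Subtype.ext (by simp [polyGerm]; rfl)

theorem polyGermHom_apply (p : MvPolynomial σ ℂ) : polyGermHom p = polyGerm p :=
  rfl

theorem germValue_polyGerm_X (i : σ) : germValue (polyGermHom (MvPolynomial.X i)) = 0 := by
  change MvPolynomial.eval (0 : σ → ℂ) (MvPolynomial.X i) = 0
  simp

variable [DecidableEq σ]

theorem partialDeriv_add (i : σ) (f g : analyticGerms σ) :
    partialDeriv i (f + g) = partialDeriv i f + partialDeriv i g := by
  obtain ⟨_, f, hf, rfl⟩ := f
  obtain ⟨_, g, hg, rfl⟩ := g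
  refine Subtype.ext (Filter.Germ.coe_eq.2 ?_)
  filter_upwards [hf.eventually_analyticAt, hg.eventually_analyticAt] with x hx hy
  change fderiv ℂ (f + g) x (Pi.single i 1) = _
  rw [fderiv_add hx.differentiableAt hy.differentiableAt]
  rfl

theorem partialDeriv_mul (i : σ) (f g : analyticGerms σ) :
    partialDeriv i (f * g) = f • partialDeriv i g + g • partialDeriv i f := by
  obtain ⟨_, f, hf, rfl⟩ := f
  obtain ⟨_, g, hg, rfl⟩ := g
  refine Subtype.ext (Filter.Germ.coe_eq.2 ?_)
  filter_upwards [hf.eventually_analyticAt, hg.eventually_analyticAt] with x hx hy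
  change fderiv ℂ (f * g) x (Pi.single i 1) = _
  rw [fderiv_mul hx.differentiableAt hy.differentiableAt]
  rfl

/-- The partial derivatives of germs as derivations. -/
noncomputable def germDerivation (i : σ) : Derivation ℤ (analyticGerms σ) (analyticGerms σ) :=
  Derivation.mk' (AddMonoidHom.mk' (partialDeriv i) (partialDeriv_add i)).toIntLinearMap
    (partialDeriv_mul i)

theorem germDerivation_polyGerm_X (i k : σ) :
    germDerivation i (polyGermHom (MvPolynomial.X k)) = if i = k then 1 else 0 := by
  have h : ∀ x : σ → ℂ, fderiv ℂ (fun x : σ → ℂ => MvPolynomial.eval x (MvPolynomial.X k)) x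
      (Pi.single i 1) = if i = k then 1 else 0 := by
    intro x
    simp only [MvPolynomial.eval_X]
    rw [(hasFDerivAt_apply k x).fderiv]
    simp [Pi.single_apply, eq_comm]
  refine Subtype.ext ((Filter.Germ.coe_eq.2 (Filter.Eventually.of_forall h)).trans ?_)
  split_ifs <;> rfl

theorem jacobianExtension_eq (k : ℕ) (J : Ideal (analyticGerms σ)) :
    jacobianExtension k J = jacExt germDerivation k J :=
  rfl

theorem upperExtension_eq (i : ℕ) :
    upperExtension (σ := σ) i = jacExt germDerivation (Fintype.card σ + 1 - i) :=
  rfl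

theorem Chart.criticalIndex_eq {J : Ideal (analyticGerms σ)} {U V : (analyticGerms σ)⟦X⟧}
    {u v α β : ℕ} (h : Chart germDerivation J U V u v α β) (hvu : v ≤ u) :
    criticalIndex J = v := by
  have h1 : {k : ℕ | jacobianExtension k J ≠ ⊤} = {k | jacExt germDerivation k J ≠ ⊤} :=
    Set.ext fun k => by rw [Set.mem_ofPred_eq, Set.mem_ofPred_eq, jacobianExtension_eq]
  have h2 := h.sInf_eq isUnit_natCast_analyticGerms hvu
  have := h.le_card isUnit_natCast_analyticGerms hvu
  rw [criticalIndex, h1, h2]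
  omega

end GermRing

/-! ### The ideal of the multiplication map -/

section Multiplication

theorem coe_reflect_monic {R : Type*} [CommRing R] (n : ℕ) (c : Fin n → R) :
    ((Polynomial.reflect n (Polynomial.X ^ n +
      ∑ i : Fin n, Polynomial.C (c i) * Polynomial.X ^ (i : ℕ)) : Polynomial R) : R⟦X⟧) =
      1 + ∑ i : Fin n, C (c i) * X ^ (n - (i : ℕ)) := by
  have hsum : Polynomial.reflect n (∑ i : Fin n, Polynomial.C (c i) * Polynomial.X ^ (i : ℕ)) =
      ∑ i : Fin n, Polynomial.C (c i) * Polynomial.X ^ (n - (i : ℕ)) := by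
    let F : Polynomial R →+ Polynomial R :=
      AddMonoidHom.mk' (Polynomial.reflect n) fun f g => Polynomial.reflect_add f g n
    have h := map_sum F (fun i : Fin n => Polynomial.C (c i) * Polynomial.X ^ (i : ℕ)) Finset.univ
    refine Eq.trans h (Finset.sum_congr rfl fun i _ => ?_)
    change Polynomial.reflect n (Polynomial.C (c i) * Polynomial.X ^ (i : ℕ)) = _
    rw [Polynomial.reflect_C_mul_X_pow, Polynomial.revAt_le i.2.le]
  rw [Polynomial.reflect_add, hsum, Polynomial.reflect_monomial, Polynomial.revAt_le le_rfl,
    Nat.sub_self, pow_zero, Polynomial.coe_add, Polynomial.coe_one]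
  congr 1
  rw [← Polynomial.coeToPowerSeries.ringHom_apply, map_sum]
  refine Finset.sum_congr rfl fun i _ => ?_
  simp

theorem coeff_monicSeries {R : Type*} [CommRing R] (n : ℕ) (c : Fin n → R) (i : Fin n) :
    coeff (n - (i : ℕ)) (1 + ∑ i : Fin n, C (c i) * X ^ (n - (i : ℕ)) : R⟦X⟧) = c i := by
  rw [map_add, map_sum, coeff_one, if_neg (by omega), zero_add, Finset.sum_eq_single i]
  · simp
  · intro j _ hj
    rw [coeff_C_mul, coeff_X_pow, if_neg, mul_zero]
    rw [Ne, Fin.ext_iff] at hj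
    omega
  · simp

theorem constantCoeff_monicSeries {R : Type*} [CommRing R] (n : ℕ) (c : Fin n → R) :
    constantCoeff (1 + ∑ i : Fin n, C (c i) * X ^ (n - (i : ℕ)) : R⟦X⟧) = 1 := by
  rw [map_add, map_sum, map_one, Finset.sum_eq_zero, add_zero]
  intro i _
  rw [map_mul, map_pow, constantCoeff_X, zero_pow (by omega), mul_zero]

theorem degLE_monicSeries {R : Type*} [CommRing R] (n : ℕ) (c : Fin n → R) :
    DegLE (1 + ∑ i : Fin n, C (c i) * X ^ (n - (i : ℕ)) : R⟦X⟧) n := by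
  intro j hj
  rw [map_add, map_sum, coeff_one, if_neg (by omega), zero_add]
  refine Finset.sum_eq_zero fun i _ => ?_
  rw [coeff_C_mul, coeff_X_pow, if_neg (by omega), mul_zero]

theorem map_monicSeries {R S : Type*} [CommRing R] [CommRing S] (π : R →+* S) (n : ℕ)
    (c : Fin n → R) :
    PowerSeries.map π (1 + ∑ i : Fin n, C (c i) * X ^ (n - (i : ℕ)) : R⟦X⟧) =
      1 + ∑ i : Fin n, C (π (c i)) * X ^ (n - (i : ℕ)) := by
  simp [map_sum]

/-- A power series which agrees with a polynomial of degree at most `n` up to order `n` and is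
itself one is equal to it. -/
theorem DegLE.eq_of_coeff {R : Type*} [CommRing R] {n : ℕ} {W Z : R⟦X⟧} (hW : DegLE W n)
    (hZ : DegLE Z n) (h0 : constantCoeff W = constantCoeff Z)
    (h : ∀ i : Fin n, coeff (n - (i : ℕ)) W = coeff (n - (i : ℕ)) Z) : W = Z := by
  ext j
  rcases lt_or_ge n j with hj | hj
  · rw [hW j hj, hZ j hj]
  · rcases j.eq_zero_or_pos with rfl | hj0
    · rwa [coeff_zero_eq_constantCoeff_apply, coeff_zero_eq_constantCoeff_apply]
    · have := h ⟨n - j, by omega⟩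
      rwa [Nat.sub_sub_self hj] at this

theorem genericF_natDegree_le (n r : ℕ) : (genericF n r).natDegree ≤ n := by
  refine Polynomial.natDegree_add_le_of_degree_le (Polynomial.natDegree_X_pow_le n)
    (Polynomial.natDegree_sum_le_of_forall_le _ _ fun i _ => ?_)
  exact (Polynomial.natDegree_C_mul_X_pow_le _ _).trans i.2.le

theorem genericG_natDegree_le (n r : ℕ) : (genericG n r).natDegree ≤ r := by
  refine Polynomial.natDegree_add_le_of_degree_le (Polynomial.natDegree_X_pow_le r)
    (Polynomial.natDegree_sum_le_of_forall_le _ _ fun i _ => ?_)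
  exact (Polynomial.natDegree_C_mul_X_pow_le _ _).trans i.2.le

theorem seriesA_mul_seriesB (n r : ℕ) : seriesA n r * seriesB n r =
    (Polynomial.reflect (n + r) (genericF n r * genericG n r) : Polynomial (CoeffPoly n r)) := by
  rw [Polynomial.reflect_mul _ _ (genericF_natDegree_le n r) (genericG_natDegree_le n r),
    Polynomial.coe_mul, genericF, genericG, coe_reflect_monic, coe_reflect_monic]
  rfl

/-- The degree relations hold identically, and `c_j` is the coefficient of `A B - 1` of order `n + r
- j`. -/
theorem multIdeal_eq (n r : ℕ) : multIdeal n r = Ideal.span (relations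
    (PowerSeries.map polyGermHom (seriesA n r)) (PowerSeries.map polyGermHom (seriesB n r))
    n r 1 1) := by
  have hdeg : ∀ j, n + r < j → (genericF n r * genericG n r).coeff j = 0 := fun j hj =>
    Polynomial.coeff_eq_zero_of_natDegree_lt (lt_of_le_of_lt (Polynomial.natDegree_mul_le_of_le
      (genericF_natDegree_le n r) (genericG_natDegree_le n r)) hj)
  have hcoeff : ∀ j, coeff j (PowerSeries.map polyGermHom (seriesA n r) ^ 1 *
      PowerSeries.map polyGermHom (seriesB n r) ^ 1 - 1) =
      polyGermHom ((genericF n r * genericG n r).coeff (Polynomial.revAt (n + r) j)) -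
        if j = 0 then 1 else 0 := fun j => by
    rw [pow_one, pow_one, ← map_mul, seriesA_mul_seriesB, map_sub, coeff_map,
      Polynomial.coeff_coe, Polynomial.coeff_reflect, coeff_one]
  have hA := map_monicSeries (polyGermHom (σ := Fin n ⊕ Fin r)) n
    fun i => MvPolynomial.X (Sum.inl i)
  have hB := map_monicSeries (polyGermHom (σ := Fin n ⊕ Fin r)) r
    fun i => MvPolynomial.X (Sum.inr i)
  have h0 : (genericF n r * genericG n r).coeff (n + r) = 1 := by
    have h1 := congrArg (coeff 0) (seriesA_mul_seriesB n r)
    rw [Polynomial.coeff_coe, Polynomial.coeff_reflect, Polynomial.revAt_le (Nat.zero_le _),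
      Nat.sub_zero, coeff_zero_eq_constantCoeff_apply, map_mul, seriesA, seriesB,
      constantCoeff_monicSeries, constantCoeff_monicSeries, one_mul] at h1
    exact h1.symm
  apply le_antisymm
  · refine Ideal.span_le.2 ?_
    rintro _ ⟨j, hj, rfl⟩
    refine Ideal.subset_span (Or.inr ⟨n + r - j, ?_⟩)
    rw [hcoeff, Polynomial.revAt_le (Nat.sub_le _ _), Nat.sub_sub_self hj.le, if_neg (by omega),
      sub_zero]
    rfl
  · refine Ideal.span_le.2 ?_
    rintro _ ((⟨j, hj, rfl⟩ | ⟨j, hj, rfl⟩) | ⟨j, rfl⟩)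
    · rw [seriesA, hA, degLE_monicSeries n _ j hj]
      exact Ideal.zero_mem _
    · rw [seriesB, hB, degLE_monicSeries r _ j hj]
      exact Ideal.zero_mem _
    · rw [hcoeff]
      rcases j.eq_zero_or_pos with rfl | hj0
      · rw [Polynomial.revAt_le (Nat.zero_le _), Nat.sub_zero, h0, map_one, if_pos rfl, sub_self]
        exact Ideal.zero_mem _
      · rw [if_neg hj0.ne', sub_zero]
        rcases le_or_gt j (n + r) with hj | hj
        · rw [Polynomial.revAt_le hj]
          exact Ideal.subset_span ⟨n + r - j, by omega, rfl⟩
        · rw [Polynomial.revAt_eq_self_of_lt hj, hdeg j hj, map_zero]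
          exact Ideal.zero_mem _

/-- The coefficients of `A` and `B` are the coordinates themselves, so a tangent vector is read off
from the coefficients of `U'` and `V'`. -/
theorem chart_multIdeal (n r : ℕ) : Chart germDerivation (multIdeal n r)
    (PowerSeries.map polyGermHom (seriesA n r)) (PowerSeries.map polyGermHom (seriesB n r))
    n r 1 1 := by
  have hA : PowerSeries.map polyGermHom (seriesA n r) = _ :=
    map_monicSeries (polyGermHom (σ := Fin n ⊕ Fin r)) n fun i => MvPolynomial.X (Sum.inl i)
  have hB : PowerSeries.map polyGermHom (seriesB n r) = _ :=
    map_monicSeries (polyGermHom (σ := Fin n ⊕ Fin r)) r fun i => MvPolynomial.X (Sum.inr i)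
  have hres : ∀ k, IsLocalRing.residue (analyticGerms (Fin n ⊕ Fin r))
      (polyGermHom (MvPolynomial.X k)) = 0 := fun k =>
    residue_eq_zero_of_germValue (germValue_polyGerm_X k)
  refine ⟨?_, ?_, ?_, ?_, one_ne_zero, one_ne_zero, multIdeal_eq n r, ?_⟩
  · rw [hA, constantCoeff_monicSeries]
  · rw [hB, constantCoeff_monicSeries]
  · rw [hA, map_monicSeries]
    simp [hres]
  · rw [hB, map_monicSeries]
    simp [hres]
  · intro S _ π _ U' V' hU0 hV0 hU hV
    have hX : ∀ (x : Fin n ⊕ Fin r → S) k,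
        tangent germDerivation π x (polyGermHom (MvPolynomial.X k)) = x k := fun x k => by
      rw [tangent_apply, Finset.sum_eq_single k]
      · rw [germDerivation_polyGerm_X, if_pos rfl, map_one, mul_one]
      · intro i _ hi
        rw [germDerivation_polyGerm_X, if_neg hi, map_zero, mul_zero]
      · simp
    have hdeg : ∀ (x : Fin n ⊕ Fin r → S) {W : (analyticGerms (Fin n ⊕ Fin r))⟦X⟧} {d : ℕ},
        DegLE W d → DegLE (coeffMap (tangent germDerivation π x) W) d := fun x W d hW j hj => by
      rw [coeff_coeffMap, hW j hj, map_zero]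
    have hconst : ∀ (x : Fin n ⊕ Fin r → S) {W : (analyticGerms (Fin n ⊕ Fin r))⟦X⟧},
        constantCoeff W = 1 → constantCoeff (coeffMap (tangent germDerivation π x) W) = 0 :=
      fun x W hW => by
        rw [← coeff_zero_eq_constantCoeff_apply, coeff_coeffMap,
          coeff_zero_eq_constantCoeff_apply, hW, (isDerivationAlong_tangent _ π x).apply_one]
    rw [hA, hB]
    refine ⟨Sum.elim (fun i => coeff (n - (i : ℕ)) U') fun i => coeff (r - (i : ℕ)) V',
      ⟨?_, ?_⟩, ?_⟩
    · refine (hdeg _ (degLE_monicSeries _ _)).eq_of_coeff hU ?_ fun i => ?_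
      · rw [hconst _ (constantCoeff_monicSeries _ _), hU0]
      · rw [coeff_coeffMap, coeff_monicSeries, hX]
        rfl
    · refine (hdeg _ (degLE_monicSeries _ _)).eq_of_coeff hV ?_ fun i => ?_
      · rw [hconst _ (constantCoeff_monicSeries _ _), hV0]
      · rw [coeff_coeffMap, coeff_monicSeries, hX]
        rfl
    · rintro y ⟨rfl, rfl⟩
      ext k
      rcases k with i | i
      · rw [Sum.elim_inl, coeff_coeffMap, coeff_monicSeries, hX]
      · rw [Sum.elim_inr, coeff_coeffMap, coeff_monicSeries, hX]

end Multiplication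

/-! ### The polynomials `ψ_k` as coefficients of power series -/

section Psi

theorem map_invOfUnit_one {R S : Type*} [CommRing R] [CommRing S] (π : R →+* S) {W : R⟦X⟧}
    (hW : constantCoeff W = 1) :
    PowerSeries.map π (invOfUnit W 1) = invOfUnit (PowerSeries.map π W) 1 := by
  have h1 : W * invOfUnit W 1 = 1 := mul_invOfUnit W 1 (by simpa using hW)
  refine left_inv_eq_right_inv (a := PowerSeries.map π W) ?_ (mul_invOfUnit _ 1 ?_)
  · rw [mul_comm, ← map_mul, h1, map_one]
  · rw [← coeff_zero_eq_constantCoeff_apply, coeff_map, coeff_zero_eq_constantCoeff_apply, hW,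
      map_one, Units.val_one]

theorem constantCoeff_seriesA (n r : ℕ) : constantCoeff (seriesA n r) = 1 :=
  constantCoeff_monicSeries n _

theorem constantCoeff_seriesB (n r : ℕ) : constantCoeff (seriesB n r) = 1 :=
  constantCoeff_monicSeries r _

theorem seriesB_mul_invB (n r : ℕ) : seriesB n r * invB n r = 1 :=
  mul_invOfUnit _ 1 (constantCoeff_seriesB n r)

variable {n r : ℕ}

/-- A partial derivative as an additive map. -/
noncomputable def pderivB (j : Fin r) : CoeffPoly n r →+ CoeffPoly n r :=
  (MvPolynomial.pderiv (Sum.inr j)).toLinearMap.toAddMonoidHom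

theorem pderivB_apply (j : Fin r) (p : CoeffPoly n r) :
    pderivB j p = MvPolynomial.pderiv (Sum.inr j) p :=
  rfl

theorem isDerivationAlong_pderivB (j : Fin r) :
    IsDerivationAlong (RingHom.id (CoeffPoly n r)) (pderivB j) := fun f g => by
  rw [pderivB_apply, Derivation.leibniz]
  rfl

theorem coeffMap_pderivB_seriesA (j : Fin r) : coeffMap (pderivB j) (seriesA n r) = 0 := by
  refine DegLE.eq_of_coeff (n := n) (fun i hi => ?_) (fun i _ => map_zero _) ?_ fun i => ?_
  · rw [coeff_coeffMap, seriesA, degLE_monicSeries _ _ i hi, map_zero]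
  · rw [← coeff_zero_eq_constantCoeff_apply, coeff_coeffMap, coeff_zero_eq_constantCoeff_apply,
      seriesA, constantCoeff_monicSeries, (isDerivationAlong_pderivB j).apply_one, map_zero]
  · rw [coeff_coeffMap, seriesA, coeff_monicSeries, pderivB_apply,
      MvPolynomial.pderiv_X_of_ne (by simp), map_zero]

theorem coeffMap_pderivB_seriesB (j : Fin r) :
    coeffMap (pderivB j) (seriesB n r) = X ^ (r - (j : ℕ)) := by
  refine DegLE.eq_of_coeff (n := r) (fun i hi => ?_) ((degLE_X_pow _).mono (Nat.sub_le _ _)) ?_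
    fun i => ?_
  · rw [coeff_coeffMap, seriesB, degLE_monicSeries _ _ i hi, map_zero]
  · rw [← coeff_zero_eq_constantCoeff_apply, coeff_coeffMap, coeff_zero_eq_constantCoeff_apply,
      seriesB, constantCoeff_monicSeries, (isDerivationAlong_pderivB j).apply_one, map_pow,
      constantCoeff_X, zero_pow (by omega)]
  · rw [coeff_coeffMap, seriesB, coeff_monicSeries, pderivB_apply, MvPolynomial.pderiv_X,
      coeff_X_pow, Pi.single_apply]
    refine if_congr ?_ rfl rfl
    rw [Sum.inr.injEq, Fin.ext_iff]
    omega

/-- `A` does not involve the `b_j` and `∂B/∂b_j = t ^ (r - j)`, so the derivative of `B ^ (-k) A` is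
`-k t ^ (r - j) B ^ (-k - 1) A`. -/
theorem pderiv_coeff_invB_pow_mul_seriesA (j : Fin r) (k m : ℕ) (hm : r - (j : ℕ) ≤ m) :
    MvPolynomial.pderiv (Sum.inr j) (coeff m (invB n r ^ k * seriesA n r)) =
      MvPolynomial.C (-(k : ℂ)) *
        coeff (m - (r - (j : ℕ))) (invB n r ^ (k + 1) * seriesA n r) := by
  have hδ := isDerivationAlong_pderivB (n := n) j
  have h : coeffMap (pderivB j) (invB n r ^ k * seriesA n r) =
      C (MvPolynomial.C (-(k : ℂ))) *
        (X ^ (r - (j : ℕ)) * (invB n r ^ (k + 1) * seriesA n r)) := by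
    rw [hδ.coeffMap_mul, coeffMap_pderivB_seriesA, hδ.coeffMap_pow,
      hδ.coeffMap_of_mul_eq_one (seriesB_mul_invB n r), coeffMap_pderivB_seriesB]
    simp only [PowerSeries.map_id, id_eq, map_neg, map_natCast]
    rcases k with _ | k
    · simp
    · rw [Nat.add_sub_cancel]
      ring
  have h1 := congrArg (coeff m) h
  rwa [coeff_coeffMap, coeff_C_mul, coeff_X_pow_mul', if_pos hm] at h1

/-- Each derivative adds one factor `B⁻¹`. Starting from order `n - r + 1`, the derivative by
`b_{r-1-i}` lowers the order by `i + 1` and each one by `b_0` by `r`; the constants accumulate to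
`(-1) ^ s * s!`. -/
theorem exists_psiBlock_eq (s : ℕ) (i : Fin r) (hs : (s + 1) * r ≤ n) :
    ∃ c : ℂ, c ≠ 0 ∧ psiBlock n r s i =
      MvPolynomial.C c * coeff (n - (s * r + i)) (invB n r ^ (s + 1) * seriesA n r) := by
  have hi := i.2
  rcases s with _ | s
  · exact ⟨1, one_ne_zero, by simp [psiBlock, dPoly, seriesD]⟩
  · induction s with
    | zero =>
      refine ⟨-1, by simp, ?_⟩
      have h := pderiv_coeff_invB_pow_mul_seriesA (n := n) i.rev 1 (n - (r - 1))
        (by rw [Fin.val_rev]; omega)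
      rw [pow_one] at h
      simp only [psiBlock, dPoly, seriesD, Function.iterate_zero, id_eq]
      rw [h, Fin.val_rev, Nat.cast_one]
      congr 3
      omega
    | succ s ih =>
      simp only [add_mul, one_mul] at hs ih
      obtain ⟨c, hc, h⟩ := ih (by omega)
      refine ⟨c * -((s + 1 + 1 : ℕ) : ℂ),
        mul_ne_zero hc (neg_ne_zero.2 (Nat.cast_ne_zero.2 (by omega))), ?_⟩
      have hstep : psiBlock n r (s + 1 + 1) i =
          MvPolynomial.pderiv (Sum.inr ⟨0, i.pos⟩) (psiBlock n r (s + 1) i) := by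
        rw [psiBlock, psiBlock, Function.iterate_succ_apply']
      rw [hstep, h, MvPolynomial.pderiv_C_mul, pderiv_coeff_invB_pow_mul_seriesA _ _ _
        (by simp only; omega), ← mul_assoc, ← map_mul]
      congr 2
      simp only [add_mul, one_mul]
      congr 1
      omega

theorem exists_psi_eq {k : ℕ} (hr : 0 < r) (hk : k < n / r * r) :
    ∃ c : ℂ, c ≠ 0 ∧ psi n r k =
      MvPolynomial.C c * coeff (n - k) (invB n r ^ (k / r + 1) * seriesA n r) := by
  have hkr : k / r + 1 ≤ n / r := Nat.succ_le_of_lt (Nat.div_lt_of_lt_mul (by rwa [mul_comm]))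
  obtain ⟨c, hc, h⟩ := exists_psiBlock_eq (n := n) (k / r) ⟨k % r, Nat.mod_lt k hr⟩
    ((Nat.mul_le_mul_right r hkr).trans (Nat.div_mul_le_self n r))
  refine ⟨c, hc, ?_⟩
  rw [psi, dif_pos hr, if_pos hk, h, Nat.div_add_mod']

end Psi

/-! ### The ideals in terms of quotients of power series -/

section Ideals

theorem sup_span_congr {A : Type*} [CommRing A] {J : Ideal A} {v : ℕ} {f g : ℕ → A}
    (h : ∀ k < v, ∃ c, IsUnit c ∧ f k - c * g k ∈ J) :
    J ⊔ Ideal.span {x | ∃ k < v, x = f k} = J ⊔ Ideal.span {x | ∃ k < v, x = g k} := by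
  apply le_antisymm
  · refine sup_le le_sup_left (Ideal.span_le.2 ?_)
    rintro _ ⟨k, hk, rfl⟩
    obtain ⟨c, -, hc⟩ := h k hk
    rw [← sub_add_cancel (f k) (c * g k)]
    exact Ideal.add_mem _ (Ideal.mem_sup_left hc)
      (Ideal.mul_mem_left _ _ (Ideal.mem_sup_right (Ideal.subset_span ⟨k, hk, rfl⟩)))
  · refine sup_le le_sup_left (Ideal.span_le.2 ?_)
    rintro _ ⟨k, hk, rfl⟩
    obtain ⟨c, hu, hc⟩ := h k hk
    rw [SetLike.mem_coe, ← Ideal.unit_mul_mem_iff_mem _ hu, ← sub_sub_cancel (f k) (c * g k)]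
    exact Ideal.sub_mem _ (Ideal.mem_sup_right (Ideal.subset_span ⟨k, hk, rfl⟩))
      (Ideal.mem_sup_left hc)

theorem isUnit_polyGermHom_C {σ : Type} [Fintype σ] {c : ℂ} (hc : c ≠ 0) :
    IsUnit (polyGermHom (MvPolynomial.C c : MvPolynomial σ ℂ)) :=
  (((isUnit_iff_ne_zero.2 hc).map MvPolynomial.C).map polyGermHom)

/-- The germ of the series `A(t)`. -/
noncomputable def germA (n r : ℕ) : (analyticGerms (Fin n ⊕ Fin r))⟦X⟧ :=
  PowerSeries.map polyGermHom (seriesA n r)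

/-- The germ of the series `B(t)`. -/
noncomputable def germB (n r : ℕ) : (analyticGerms (Fin n ⊕ Fin r))⟦X⟧ :=
  PowerSeries.map polyGermHom (seriesB n r)

/-- The germ of the series `B(t)⁻ᵠ A(t)`, with `q` the quotient of `n` by `r`. -/
noncomputable def germP (n r : ℕ) : (analyticGerms (Fin n ⊕ Fin r))⟦X⟧ :=
  germA n r * invOfUnit (germB n r) 1 ^ (n / r)

theorem map_polyGermHom_invB (n r : ℕ) :
    PowerSeries.map polyGermHom (invB n r) = invOfUnit (germB n r) 1 :=
  map_invOfUnit_one _ (constantCoeff_seriesB n r)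

/-- The ideal reached after the first `n / r` critical extensions. -/
noncomputable def psiIdeal (n r : ℕ) : Ideal (analyticGerms (Fin n ⊕ Fin r)) :=
  multIdeal n r ⊔ Ideal.span (quotientConditions (germA n r) (germB n r) n r (n / r))

theorem psiIdeal_eq (n r : ℕ) (hr : 0 < r) : psiIdeal n r =
    multIdeal n r ⊔ Ideal.span {h | ∃ k < n / r * r, h = polyGerm (psi n r k)} := by
  refine Eq.symm (sup_span_congr fun k hk => ?_)
  obtain ⟨c, hc, h⟩ := exists_psi_eq hr hk
  refine ⟨_, isUnit_polyGermHom_C hc, ?_⟩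
  have : polyGerm (psi n r k) = polyGermHom (MvPolynomial.C c) *
      coeff (n - k) (germA n r * invOfUnit (germB n r) 1 ^ (k / r + 1)) := by
    rw [← polyGermHom_apply, h, map_mul, ← coeff_map, map_mul, map_pow, map_polyGermHom_invB,
      mul_comm (germA n r)]
    rfl
  rw [this, sub_self]
  exact Ideal.zero_mem _

theorem extendedIdeal_eq (n r v : ℕ) (hr : 0 < r) : extendedIdeal n r (n / r * r) v =
    psiIdeal n r ⊔ Ideal.span {h | ∃ k < v, h = polyGerm (phi n r k)} := by
  rw [psiIdeal_eq n r hr, extendedIdeal, Ideal.span_union, sup_assoc]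

/-- After all divisions of `A` by `B` the quotient `P` has degree bound `n % r`, so the roles are
exchanged: next `B` is divided by `P`. -/
theorem chart_psiIdeal (n r : ℕ) : Chart germDerivation (psiIdeal n r) (germB n r) (germP n r)
    r (n % r) (1 + n / r * 1) 1 := by
  have h := ((chart_multIdeal n r).quotient_pow (n / r) (Nat.div_mul_le_self n r)).symm
  have hmod : n - n / r * r = n % r := by
    have := Nat.div_add_mod' n r
    omega
  rwa [hmod] at h

/-! ### The polynomials `φ_k` modulo the ideal of the `ψ_k` -/

section Phi

variable {n r : ℕ}

/-- The substitution in the definition of the polynomials `φ_k`. -/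
noncomputable def phiSubst (n r : ℕ) : CoeffPoly r (n % r) →ₐ[ℂ] CoeffPoly n r :=
  MvPolynomial.aeval
    (Sum.elim (fun j : Fin r => (MvPolynomial.X (Sum.inr j) : CoeffPoly n r))
      (fun j : Fin (n % r) => gammaPoly n r (n - n % r + (j : ℕ))))

theorem map_phiSubst_seriesA :
    PowerSeries.map (phiSubst n r : CoeffPoly r (n % r) →+* CoeffPoly n r) (seriesA r (n % r)) =
      seriesB n r := by
  rw [seriesA, map_monicSeries]
  simp [phiSubst, seriesB]

/-- The composition of the substitution with the reduction modulo the ideal `psiIdeal`. -/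
noncomputable def phiReduction (n r : ℕ) :
    CoeffPoly r (n % r) →+* analyticGerms (Fin n ⊕ Fin r) ⧸ psiIdeal n r :=
  ((Ideal.Quotient.mk (psiIdeal n r)).comp polyGermHom).comp
    (phiSubst n r : CoeffPoly r (n % r) →+* CoeffPoly n r)

theorem map_phiReduction (W : (CoeffPoly r (n % r))⟦X⟧) : PowerSeries.map (phiReduction n r) W =
    PowerSeries.map (Ideal.Quotient.mk (psiIdeal n r)) (PowerSeries.map polyGermHom
      (PowerSeries.map (phiSubst n r : CoeffPoly r (n % r) →+* CoeffPoly n r) W)) :=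
  rfl

theorem map_phiReduction_seriesA : PowerSeries.map (phiReduction n r) (seriesA r (n % r)) =
    PowerSeries.map (Ideal.Quotient.mk (psiIdeal n r)) (germB n r) := by
  rw [map_phiReduction, map_phiSubst_seriesA]
  rfl

/-- The `γ`'s substituted are only the coefficients of `P` of orders `1, …, n % r`. They determine
`P` modulo `psiIdeal`, where the higher coefficients vanish. -/
theorem map_phiReduction_seriesB :
    PowerSeries.map (phiReduction n r) (seriesB r (n % r)) =
      PowerSeries.map (Ideal.Quotient.mk (psiIdeal n r)) (germP n r) := by
  have hchart := chart_psiIdeal n r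
  have hmod : n % r ≤ n := Nat.mod_le n r
  rw [seriesB, map_monicSeries]
  refine (degLE_monicSeries _ _).eq_of_coeff (hchart.forall_map_eq_zero_iff.1
    fun f hf => Ideal.Quotient.eq_zero_iff_mem.2 hf).2.1 ?_ fun i => ?_
  · rw [constantCoeff_monicSeries, ← coeff_zero_eq_constantCoeff_apply, coeff_map,
      coeff_zero_eq_constantCoeff_apply, hchart.constantCoeff_right, map_one]
  · rw [coeff_monicSeries, coeff_map]
    have hX : phiReduction n r (MvPolynomial.X (Sum.inr i)) = Ideal.Quotient.mk (psiIdeal n r)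
        (polyGermHom (gammaPoly n r (n - n % r + (i : ℕ)))) := by
      simp [phiReduction, phiSubst]
    have hidx : n - (n - n % r + (i : ℕ)) = n % r - i := by omega
    rw [hX, gammaPoly, hidx, ← coeff_map, map_mul, map_pow, map_polyGermHom_invB, germP,
      mul_comm (germA n r)]
    rfl

theorem map_phiReduction_invB :
    PowerSeries.map (phiReduction n r) (invB r (n % r)) =
      PowerSeries.map (Ideal.Quotient.mk (psiIdeal n r)) (invOfUnit (germP n r) 1) := by
  rw [invB, map_invOfUnit_one _ (constantCoeff_seriesB _ _), map_phiReduction_seriesB,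
    map_invOfUnit_one _ (chart_psiIdeal n r).constantCoeff_right]

theorem mk_polyGerm_phi (k : ℕ) : Ideal.Quotient.mk (psiIdeal n r) (polyGerm (phi n r k)) =
    phiReduction n r (psi r (n % r) k) :=
  rfl

theorem exists_phi_sub_mem {k : ℕ} (hr₁ : 0 < n % r)
    (hk : k < r / (n % r) * (n % r)) :
    ∃ c, IsUnit c ∧ polyGerm (phi n r k) -
      c * coeff (r - k) (germB n r * invOfUnit (germP n r) 1 ^ (k / (n % r) + 1)) ∈
        psiIdeal n r := by
  obtain ⟨c, hc, h⟩ := exists_psi_eq hr₁ hk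
  refine ⟨_, isUnit_polyGermHom_C hc, ?_⟩
  have hC : phiReduction n r (MvPolynomial.C c) =
      Ideal.Quotient.mk (psiIdeal n r) (polyGermHom (MvPolynomial.C c)) := by
    simp [phiReduction]
  rw [← Ideal.Quotient.eq_zero_iff_mem, map_sub, mk_polyGerm_phi, h,
    RingHom.map_mul (phiReduction n r), RingHom.map_mul (Ideal.Quotient.mk (psiIdeal n r)), hC,
    ← coeff_map, ← coeff_map, RingHom.map_mul (PowerSeries.map _),
    RingHom.map_mul (PowerSeries.map _), map_pow, map_pow, map_phiReduction_invB,
    map_phiReduction_seriesA, mul_comm (PowerSeries.map _ (germB n r)), sub_self]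

/-- Under the substitution `(B ^ (-q) D)⁻¹` becomes `(P ^ (-q₂) P⁻¹ B)⁻¹ = P (B P ^ (-q₂))⁻¹`, the
quotient of the next chart. The index of `β` corresponds to order `r₁ - i`, as `r = q₂ r₁ + r₂`. -/
theorem phi_sub_mem (i : ℕ) (hr₁ : 0 < n % r) (hr₁r : n % r ≤ r) :
    polyGerm (phi n r (r / (n % r) * (n % r) + i)) -
      coeff (n % r - i) (germP n r *
        invOfUnit (germB n r * invOfUnit (germP n r) 1 ^ (r / (n % r))) 1) ∈ psiIdeal n r := by
  have hchart := chart_psiIdeal n r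
  have hq : 0 < r / (n % r) := Nat.div_pos hr₁r hr₁
  have hdm := Nat.div_add_mod' r (n % r)
  have hmul : r / (n % r) * (n % r) = (r / (n % r) - 1) * (n % r) + n % r := by
    obtain ⟨q, hq'⟩ := Nat.exists_eq_succ_of_ne_zero hq.ne'
    rw [hq', Nat.succ_sub_one, Nat.succ_mul]
  have hidx : r - ((r / (n % r) - 1) * (n % r) + r % (n % r) + i) = n % r - i := by omega
  have hPinv : germP n r * invOfUnit (germP n r) 1 = 1 := hchart.mul_inv
  have hI0 : constantCoeff (invOfUnit (germP n r) 1) = 1 := by simp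
  have hR0 : constantCoeff (germB n r * invOfUnit (germP n r) 1 ^ (r / (n % r))) = 1 := by
    rw [map_mul, map_pow, hI0, hchart.constantCoeff_left, one_pow, one_mul]
  have hB0 : constantCoeff (invB r (n % r) ^ (r / (n % r)) * seriesD r (n % r)) = 1 := by
    rw [seriesD, map_mul, map_mul, map_pow, invB, constantCoeff_invOfUnit, constantCoeff_seriesA]
    simp
  have hRinv : (germB n r * invOfUnit (germP n r) 1 ^ (r / (n % r))) *
      invOfUnit (germB n r * invOfUnit (germP n r) 1 ^ (r / (n % r))) 1 = 1 :=
    mul_invOfUnit _ 1 (by simpa using hR0)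
  rw [← Ideal.Quotient.eq_zero_iff_mem, map_sub, sub_eq_zero, mk_polyGerm_phi, psi, dif_pos hr₁,
    if_neg (by omega), Nat.add_sub_cancel_left, betaPoly, hidx, ← coeff_map, ← coeff_map]
  congr 1
  rw [map_invOfUnit_one _ hB0, seriesD, map_mul, map_mul, map_pow, map_phiReduction_invB,
    map_phiReduction_seriesA, ← map_pow, ← map_mul, ← map_mul, ← map_invOfUnit_one]
  · congr 1
    refine left_inv_eq_right_inv (a := invOfUnit (germP n r) 1 ^ (r / (n % r)) *
      (invOfUnit (germP n r) 1 * germB n r)) ?_ ?_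
    · rw [mul_comm]
      refine mul_invOfUnit _ 1 ?_
      rw [map_mul, map_mul, map_pow, hI0, hchart.constantCoeff_left]
      simp
    · linear_combination hRinv * (germP n r * invOfUnit (germP n r) 1) + hPinv
  · rw [map_mul, map_mul, map_pow, hI0, hchart.constantCoeff_left]
    simp

end Phi

/-! ### Iterated critical extensions and the symbol -/

theorem upperExtension_iterate {σ : Type} [Fintype σ] [DecidableEq σ]
    {J : Ideal (analyticGerms σ)} {U V : (analyticGerms σ)⟦X⟧} {u v α β : ℕ}
    (h : Chart germDerivation J U V u v α β) (s : ℕ) (hs : s * v ≤ u) :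
    (upperExtension v)^[s] J = J ⊔ Ideal.span (quotientConditions U V u v s) := by
  rw [upperExtension_eq]
  exact h.iterate_jacExt isUnit_natCast_analyticGerms s hs

/-- While division by `V` remains possible every ideal of the chain has a chart with the same `v`,
so its critical index stays `v`. -/
theorem criticalChain_add {σ : Type} [Fintype σ] [DecidableEq σ]
    {I J : Ideal (analyticGerms σ)} {U V : (analyticGerms σ)⟦X⟧} {u v α β m : ℕ}
    (h : Chart germDerivation J U V u v α β) (hm : criticalChain I m = J) (s : ℕ)
    (hs : s * v ≤ u) :
    criticalChain I (m + s) = J ⊔ Ideal.span (quotientConditions U V u v s) := by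
  rw [← upperExtension_iterate h s hs]
  induction s with
  | zero => exact hm
  | succ s ih =>
    rw [add_mul, one_mul] at hs
    have hc := h.quotient_pow s (by omega)
    rw [← upperExtension_iterate h s (by omega)] at hc
    rw [← add_assoc, criticalChain, ih (by omega), hc.criticalIndex_eq (by omega),
      Function.iterate_succ_apply']

theorem tbSymbol_add {σ : Type} [Fintype σ] [DecidableEq σ]
    {I J : Ideal (analyticGerms σ)} {U V : (analyticGerms σ)⟦X⟧} {u v α β m : ℕ}
    (h : Chart germDerivation J U V u v α β) (hm : criticalChain I m = J) (s : ℕ)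
    (hs : (s + 1) * v ≤ u) : tbSymbol I (m + s) = v := by
  rw [add_mul, one_mul] at hs
  rw [tbSymbol, criticalChain_add h hm s (by omega)]
  exact (h.quotient_pow s (by omega)).criticalIndex_eq (by omega)

/-- The ideals and the beginning of the Thom-Boardman symbol, in terms of quotients and
remainders. -/
theorem multIdeal_extensions (n r : ℕ) (hr : 0 < r) (hr₁ : 0 < n % r) :
    (∀ s ≤ r / (n % r), (upperExtension (n % r))^[s] ((upperExtension r)^[n / r] (multIdeal n r)) =
      extendedIdeal n r (n / r * r) (s * (n % r))) ∧
    upperExtension (r % (n % r)) ((upperExtension (n % r))^[r / (n % r)]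
      ((upperExtension r)^[n / r] (multIdeal n r))) =
        extendedIdeal n r (n / r * r) (r / (n % r) * (n % r) + r % (n % r)) ∧
    (List.range (n / r + r / (n % r) + 1)).map (tbSymbol (multIdeal n r)) =
      List.replicate (n / r) r ++ List.replicate (r / (n % r)) (n % r) ++ [r % (n % r)] := by
  have hr₁r : n % r ≤ r := (Nat.mod_lt n hr).le
  have h0 : Chart germDerivation (multIdeal n r) (germA n r) (germB n r) n r 1 1 :=
    chart_multIdeal n r
  have h1 := chart_psiIdeal n r
  have h2 := (h1.quotient_pow (r / (n % r)) (Nat.div_mul_le_self r _)).symm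
  -- After `q₂` divisions of `B` by `P` the roles change again: `P` is to be divided by `B P ^
  -- (-q₂)`, of degree bound `r₂`.
  have hmod : r - r / (n % r) * (n % r) = r % (n % r) := by
    have := Nat.div_add_mod' r (n % r)
    omega
  rw [hmod] at h2
  have hlt : r % (n % r) ≤ n % r := (Nat.mod_lt r hr₁).le
  have e1 : (upperExtension r)^[n / r] (multIdeal n r) = psiIdeal n r :=
    upperExtension_iterate h0 _ (Nat.div_mul_le_self n r)
  have hphi : ∀ s ≤ r / (n % r),
      psiIdeal n r ⊔ Ideal.span (quotientConditions (germB n r) (germP n r) r (n % r) s) =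
        extendedIdeal n r (n / r * r) (s * (n % r)) := fun s hs => by
    rw [extendedIdeal_eq n r _ hr]
    exact Eq.symm (sup_span_congr fun k hk => exists_phi_sub_mem hr₁
      (hk.trans_le (Nat.mul_le_mul_right _ hs)))
  have e2 : ∀ s ≤ r / (n % r), (upperExtension (n % r))^[s] (psiIdeal n r) =
      psiIdeal n r ⊔ Ideal.span (quotientConditions (germB n r) (germP n r) r (n % r) s) :=
    fun s hs => upperExtension_iterate h1 s
      ((Nat.mul_le_mul_right _ hs).trans (Nat.div_mul_le_self r _))
  refine ⟨fun s hs => by rw [e1, e2 s hs, hphi s hs], ?_, ?_⟩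
  · have hv := h2.le_card isUnit_natCast_analyticGerms hlt
    have hsplit : {h | ∃ k < r / (n % r) * (n % r) + r % (n % r), h = polyGerm (phi n r k)} =
        {h | ∃ k < r / (n % r) * (n % r), h = polyGerm (phi n r k)} ∪
          {h | ∃ i < r % (n % r), h = polyGerm (phi n r (r / (n % r) * (n % r) + i))} := by
      ext h
      constructor
      · rintro ⟨k, hk, rfl⟩
        rcases lt_or_ge k (r / (n % r) * (n % r)) with hlt | hge
        · exact Or.inl ⟨k, hlt, rfl⟩
        · exact Or.inr ⟨k - r / (n % r) * (n % r), by omega, by rw [Nat.add_sub_cancel' hge]⟩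
      · rintro (⟨k, hk, rfl⟩ | ⟨i, hi, rfl⟩)
        · exact ⟨k, by omega, rfl⟩
        · exact ⟨_, by omega, rfl⟩
    -- The last extension adjoins a window of `r₂` coefficients, empty if `r₂ = 0`; these match the
    -- `β`-block of the `φ_k` modulo `psiIdeal`.
    rw [e1, e2 _ le_rfl, upperExtension_eq,
      h2.jacExt_eq isUnit_natCast_analyticGerms hlt (by omega), window_eq hlt,
      extendedIdeal_eq n r _ hr, hsplit, Ideal.span_union, ← sup_assoc,
      ← extendedIdeal_eq n r _ hr, hphi _ le_rfl]
    refine Eq.symm (sup_span_congr fun i hi => ⟨1, isUnit_one, ?_⟩)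
    rw [one_mul, extendedIdeal_eq n r _ hr]
    exact Ideal.mem_sup_left (phi_sub_mem i hr₁ hr₁r)
  · have c1 : criticalChain (multIdeal n r) (n / r) = psiIdeal n r := by
      have := criticalChain_add (I := multIdeal n r) (m := 0) h0 rfl (n / r)
        (Nat.div_mul_le_self n r)
      rwa [zero_add] at this
    have c2 := criticalChain_add h1 c1 (r / (n % r)) (Nat.div_mul_le_self r _)
    rw [List.range_succ, List.range_add, List.map_append, List.map_append, List.map_map]
    congr 1
    · congr 1
      · refine List.eq_replicate_iff.2 ⟨by simp, fun b hb => ?_⟩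
        obtain ⟨s, hs, rfl⟩ := List.mem_map.1 hb
        rw [List.mem_range] at hs
        rw [← zero_add s]
        exact tbSymbol_add (m := 0) h0 rfl s
          ((Nat.mul_le_mul_right r hs).trans (Nat.div_mul_le_self n r))
      · refine List.eq_replicate_iff.2 ⟨by simp, fun b hb => ?_⟩
        obtain ⟨s, hs, rfl⟩ := List.mem_map.1 hb
        rw [List.mem_range] at hs
        exact tbSymbol_add h1 c1 s
          ((Nat.mul_le_mul_right _ hs).trans (Nat.div_mul_le_self r _))
    · rw [List.map_singleton, tbSymbol, c2, h2.criticalIndex_eq hlt]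

end Ideals

end ThomBoardman

theorem theorem3p14 (n r q₁ r₁ q₂ r₂ : ℕ) (hrn : r ≤ n)
    (hn : n = q₁ * r + r₁) (hr₁ : 0 < r₁) (hr₁r : r₁ < r)
    (hr : r = q₂ * r₁ + r₂) (hr₂ : r₂ < r₁) :
    (∀ s : ℕ, 1 ≤ s → s ≤ q₂ →
      (ThomBoardman.upperExtension r₁)^[s]
          ((ThomBoardman.upperExtension r)^[q₁] (ThomBoardman.multIdeal n r)) =
        ThomBoardman.extendedIdeal n r (q₁ * r) (s * r₁)) ∧
    ThomBoardman.upperExtension r₂ ((ThomBoardman.upperExtension r₁)^[q₂]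
          ((ThomBoardman.upperExtension r)^[q₁] (ThomBoardman.multIdeal n r))) =
        ThomBoardman.extendedIdeal n r (q₁ * r) (q₂ * r₁ + r₂) ∧
    (List.range (q₁ + q₂ + 1)).map (ThomBoardman.tbSymbol (ThomBoardman.multIdeal n r)) =
      List.replicate q₁ r ++ List.replicate q₂ r₁ ++ [r₂] := by
  have hpos : 0 < r := hr₁.trans hr₁r
  obtain ⟨hq₁, hm₁⟩ := (Nat.div_mod_unique hpos).2 (⟨by rw [hn]; ring, hr₁r⟩ : r₁ + r * q₁ = n ∧ _)
  obtain ⟨hq₂, hm₂⟩ := (Nat.div_mod_unique hr₁).2 (⟨by rw [hr]; ring, hr₂⟩ : r₂ + r₁ * q₂ = r ∧ _)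
  subst hm₁
  subst hq₁ hm₂ hq₂
  obtain ⟨h1, h2, h3⟩ := ThomBoardman.multIdeal_extensions n r (hr₁.trans hr₁r) hr₁
  exact ⟨fun s _ hs => h1 s hs, h2, h3⟩
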